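/- Let $H$ be a separable (real or complex) Hilbert space and $A:D(A)\subset H\to H$ a linear operator whose domain need not be dense. Put $H_0=\overline{D(A)}$, and let $A_0$ be the part of $A$ in $H_0$, i.e. $D(A_0)=\{x\in D(A): Ax\in H_0\}$ and $A_0x=Ax$. Assume that $A_0$ generates an analytic $C_0$-semigroup $(T_0(t))_{t\ge 0}$ on $H_0$, and that there are $\omega\in\mathbb R$ and $p^*\in[1,\infty)$ with $(\omega,\infty)\subset\rho(A)$ and $\limsup_{\lambda\to+\infty}\lambda^{1/p^*}\|R(\lambda,A)\|<\infty$, where $R(\lambda,A)=(\lambda I-A)^{-1}$. Let $$S_A(t)=(\lambda I-A_0)\int_0^tT_0(s)\,ds\,R(\lambda,A)\qquad(t\ge 0)$$ be the integrated semigroup generated by $A$ (the right-hand side is the same for all large $\lambda$). Let $\tau>0$ and assume $$\int_0^\tau\|S_A(r)\|_{\mathcal L_2(H)}^2\,dr<\infty,\qquad \int_0^\tau\Big\|\frac{dS_A}{dr}(r)\Big\|_{\mathcal L_2(H)}^2\,dr<\infty,$$ where $\|\cdot\|_{\mathcal L_2(H)}$ is the Hilbert–Schmidt norm. Let $(\varphi_j)_{j\ge1}$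 be an orthonormal basis of $L^2(0,\tau;H)$ consisting of functions that are smooth on $[0,\tau]$, let $(\eta_j)_{j\ge1}$ be independent real $\mathcal N(0,1)$ random variables on a probability space $(\Omega,\mathcal F,\mathbb P)$, and put $\dot W_N(t)=\sum_{j=1}^N\eta_j\varphi_j(t)$. The white noise is $\dot W(\psi)=\sum_{j}\eta_j\langle\varphi_j,\psi\rangle$ for $\psi\in L^2(0,\tau;H)$ (convergence in $L^2(\Omega)$); its natural (completed) filtration $\mathbb F=(\mathcal F_t)$ is generated by the variables $\dot W(\psi)$ with $\psi=0$ on $(t,\tau]$. Stochastic integrals are the limits $$\int_0^t\Phi(s)\,dW(s)=\lim_{N\to\infty}\sum_{j=1}^N\eta_j\int_0^t\Phi(s)\varphi_j(s)\,ds\quad\text{in }L^2(\Omega;H).$$ Then for every $\xi\in H_0$ the following holds. 1. For every $N$ and every $o\in\Omega$ there is exactly one integrated solution $X_N(\cdot,o)$ on $[0,\tau]$ of $X_N'=AX_N+\dot W_N$, $X_N(0)=\xi$, that is, exactly one continuous $u:[0,\tau]\to H$ such that for all $t\in[0,\tau]$ one has $\int_0^tu(s)\,ds\in D(A)$ and $u(t)=\xi+A\int_0^tu(s)\,ds+\int_0^t\dot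 W_N(s,o)\,ds$. Moreover $X_N\in C([0,\tau];L^2_{\mathcal F_\tau}(\Omega;H))$. 2. There is an $\mathbb F$-adapted, mean-square continuous process $X$, i.e. $X\in\mathcal C_{\mathbb F}([0,\tau];L^2(\Omega;H))$, such that $$\lim_{N\to\infty}\ \sup_{t\in[0,\tau]}\mathbb E\|X_N(t)-X(t)\|^2=0 .$$ 3. $X$ is the mild solution of $dX=AX\,dt+dW$, $X(0)=\xi$: for every $t\in[0,\tau]$, almost surely, $X(t)=T_0(t)\xi+\int_0^t\frac{dS_A}{dt}(t-s)\,dW(s)$. It is also an integrated solution, in the following sense (the identity $X(t)=\xi+A\int_0^tX(s)\,ds+W(t)$ has to be read after application of $R(\lambda,A)$, because $W(t)$ is not $H$-valued): for every $\lambda>\omega$ and $t\in[0,\tau]$, almost surely, $$R(\lambda,A)X(t)=R(\lambda,A)\xi+A\,R(\lambda,A)\int_0^tX(s)\,ds+\int_0^tR(\lambda,A)\,dW(s),$$ where $\int_0^t X(s)\,ds$ is the integral of the continuous $L^2(\Omega;H)$-valued function $X$. 4. For all $\lambda>\omega$ and $t\in[0,\tau]$ the stochastic integral $\int_0^tT_0(t-s)\lambda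 R(\lambda,A)\,dW(s)$ exists, and for suitable versions of these integrals and every $t\in[0,\tau]$ $$X(t)=T_0(t)\xi+\lim_{\lambda\to+\infty}\int_0^tT_0(t-s)\,\lambda R(\lambda,A)\,dW(s),$$ where the limit exists both almost surely and in $L^2(\Omega;H)$. -/

import Mathlib

open Set Filter Topology MeasureTheory ProbabilityTheory
open scoped ENNReal ContDiff

noncomputable section

section Operators

variable {𝕜 : Type*} [RCLike 𝕜] {H : Type*} [NormedAddCommGroup H] [InnerProductSpace 𝕜 H]

/-- `H₀`, the closure of `D(A)`. -/
abbrev domClosure (A : H →ₗ.[𝕜] H) : Submodule 𝕜 H := A.domain.topologicalClosure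

/-- `R` is the bounded two-sided inverse of `l I - A : D(A) → H`. -/
def IsResolventAt (A : H →ₗ.[𝕜] H) (l : 𝕜) (R : H →L[𝕜] H) : Prop :=
  (∀ x : H, ∃ h : R x ∈ A.domain, l • R x - A ⟨R x, h⟩ = x) ∧
    ∀ x : A.domain, R (l • (x : H) - A x) = x

/-- The resolvent set `ρ(A)` of an unbounded operator. -/
def opResolventSet (A : H →ₗ.[𝕜] H) : Set 𝕜 := {l | ∃ R : H →L[𝕜] H, IsResolventAt A l R}

open Classical in
/-- The resolvent `R(l, A) = (l I - A)⁻¹` for `l ∈ ρ(A)` (and `0` otherwise). -/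
def opResolvent (A : H →ₗ.[𝕜] H) (l : 𝕜) : H →L[𝕜] H :=
  if h : ∃ R : H →L[𝕜] H, IsResolventAt A l R then h.choose else 0

theorem opResolvent_mem_domain (A : H →ₗ.[𝕜] H) (l : 𝕜) (x : H) :
    opResolvent A l x ∈ A.domain := by
  unfold opResolvent
  split_ifs with h
  · exact (h.choose_spec.1 x).1
  · simp

/-- The resolvent `R(l, A)` as a map from `H` into `H₀`. -/
def opResolventClosure (A : H →ₗ.[𝕜] H) (l : 𝕜) : H →L[𝕜] domClosure A :=
  (opResolvent A l).codRestrict (domClosure A)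
    (fun x => A.domain.le_topologicalClosure (opResolvent_mem_domain A l x))

/-- `A₀`, the part of `A` in `H₀`: `D(A₀) = {x ∈ D(A) : A x ∈ H₀}` and `A₀ x = A x`. -/
def partInClosure (A : H →ₗ.[𝕜] H) : domClosure A →ₗ.[𝕜] domClosure A where
  domain :=
    { carrier := {x | ∃ h : (x : H) ∈ A.domain, A ⟨x, h⟩ ∈ domClosure A}
      add_mem' := by
        rintro x y ⟨hx, hx'⟩ ⟨hy, hy'⟩
        refine ⟨A.domain.add_mem hx hy, ?_⟩
        have h : A ⟨(x : H) + y, A.domain.add_mem hx hy⟩ = A ⟨x, hx⟩ + A ⟨y, hy⟩ :=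
          A.map_add ⟨x, hx⟩ ⟨y, hy⟩
        change A ⟨(x : H) + y, A.domain.add_mem hx hy⟩ ∈ domClosure A
        rw [h]
        exact Submodule.add_mem _ hx' hy'
      zero_mem' := by
        refine ⟨A.domain.zero_mem, ?_⟩
        have h : A ⟨(0 : H), A.domain.zero_mem⟩ = 0 := A.map_zero
        change A ⟨(0 : H), A.domain.zero_mem⟩ ∈ domClosure A
        rw [h]
        exact Submodule.zero_mem _
      smul_mem' := by
        rintro c x ⟨hx, hx'⟩
        refine ⟨A.domain.smul_mem c hx, ?_⟩
        have h : A ⟨c • (x : H), A.domain.smul_mem c hx⟩ = c • A ⟨x, hx⟩ :=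
          A.map_smul c ⟨x, hx⟩
        change A ⟨c • (x : H), A.domain.smul_mem c hx⟩ ∈ domClosure A
        rw [h]
        exact Submodule.smul_mem _ c hx' }
  toFun :=
    { toFun := fun x => ⟨A ⟨x, x.2.choose⟩, x.2.choose_spec⟩
      map_add' := fun x y => Subtype.ext (A.map_add ⟨x, x.2.choose⟩ ⟨y, y.2.choose⟩)
      map_smul' := fun c x => Subtype.ext (A.map_smul c ⟨x, x.2.choose⟩) }

end Operators

section Semigroups

variable {𝕜 : Type*} [RCLike 𝕜] {E : Type*} [NormedAddCommGroup E] [NormedSpace 𝕜 E]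

/-- A strongly continuous semigroup `(T t)_{t ≥ 0}` of bounded operators
(values at negative times are irrelevant). -/
structure IsC0Semigroup (T : ℝ → E →L[𝕜] E) : Prop where
  zero : T 0 = ContinuousLinearMap.id 𝕜 E
  add : ∀ s t : ℝ, 0 ≤ s → 0 ≤ t → T (s + t) = (T s).comp (T t)
  strongCont : ∀ x : E, Tendsto (fun t => T t x) (𝓝[>] 0) (𝓝 x)

variable [NormedSpace ℝ E]

/-- `B` is the infinitesimal generator of `T`: `x ∈ D(B)` and `B x = y` if and only if
`(T t x - x) / t → y` as `t ↓ 0`. -/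
def IsSemigroupGenerator (T : ℝ → E →L[𝕜] E) (B : E →ₗ.[𝕜] E) : Prop :=
  ∀ x y : E, Tendsto (fun t : ℝ => t⁻¹ • (T t x - x)) (𝓝[>] 0) (𝓝 y) ↔
    ∃ h : x ∈ B.domain, B ⟨x, h⟩ = y

/-- The open sector `{z ≠ 0 : |arg z| < θ}`. -/
def openSector (θ : ℝ) : Set ℂ := {z | z ≠ 0 ∧ |z.arg| < θ}

variable [IsScalarTower ℝ 𝕜 E]

/-- `T` is an analytic semigroup: for some `θ ∈ (0, π/2]` it extends to a holomorphic
semigroup on the sector of half-angle `θ` which is strongly continuous at `0` along every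
smaller sector.

So that real and complex spaces are covered at once, the extension takes its values in the
complexification, where it is written `U z + i V z`: holomorphy is the Cauchy-Riemann system,
the semigroup law is the complex product of `U z + i V z` and `U w + i V w`, and
`U t + i V t = T t` for `t > 0`. Over `𝕜 = ℂ` this is the usual notion: a holomorphic extension
`S z` yields `U z = (S z + S (conj z)) / 2`, `V z = (S z - S (conj z)) / (2 i)`, and conversely
`S z = U z + i V z`. -/
def IsAnalyticSemigroup (T : ℝ → E →L[𝕜] E) : Prop :=
  ∃ θ : ℝ, 0 < θ ∧ θ ≤ Real.pi / 2 ∧ ∃ U V : ℂ → E →L[𝕜] E,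
    (∀ z ∈ openSector θ, ∃ a b : E →L[𝕜] E,
      HasFDerivAt U (Complex.reCLM.smulRight a - Complex.imCLM.smulRight b) z ∧
      HasFDerivAt V (Complex.reCLM.smulRight b + Complex.imCLM.smulRight a) z) ∧
    (∀ z ∈ openSector θ, ∀ w ∈ openSector θ,
      U (z + w) = (U z).comp (U w) - (V z).comp (V w) ∧
      V (z + w) = (U z).comp (V w) + (V z).comp (U w)) ∧
    (∀ t : ℝ, 0 < t → U t = T t ∧ V t = 0) ∧
    (∀ θ' : ℝ, 0 < θ' → θ' < θ → ∀ x : E,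
      Tendsto (fun z => U z x) (𝓝[openSector θ'] 0) (𝓝 x) ∧
      Tendsto (fun z => V z x) (𝓝[openSector θ'] 0) (𝓝 0))

end Semigroups

section Cauchy

variable {𝕜 : Type*} [RCLike 𝕜] {H : Type*} [NormedAddCommGroup H] [InnerProductSpace 𝕜 H]
  [NormedSpace ℝ H] [IsScalarTower ℝ 𝕜 H]

/-- The standing assumption on `A`: (a) the part `A₀` of `A` in `H₀` generates the analytic
semigroup `T` on `H₀`; (b) `1 ≤ p < ∞`, `(w, ∞) ⊆ ρ(A)` and
`limsup_{l → ∞} l ^ (1/p) ‖R(l, A)‖ < ∞`. -/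
structure AlmostSectorialAssumption (A : H →ₗ.[𝕜] H)
    (T : ℝ → domClosure A →L[𝕜] domClosure A) (w p : ℝ) : Prop where
  semigroup : IsC0Semigroup T
  analytic : IsAnalyticSemigroup T
  generator : IsSemigroupGenerator T (partInClosure A)
  one_le : 1 ≤ p
  resolvent : ∀ l : ℝ, w < l → (l : 𝕜) ∈ opResolventSet A
  limsup_lt_top :
    limsup (fun l : ℝ => ENNReal.ofReal (l ^ (1 / p) * ‖opResolvent A (l : 𝕜)‖)) atTop < ⊤

/-- `S = (l I - A₀) ∫₀ᵗ T s ds (l I - A)⁻¹` for all large real `l`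
(the right-hand side does not depend on `l`). -/
def IsIntegratedSemigroupAt (A : H →ₗ.[𝕜] H) (T : ℝ → domClosure A →L[𝕜] domClosure A)
    (t : ℝ) (S : H →L[𝕜] H) : Prop :=
  ∀ᶠ l : ℝ in atTop, (l : 𝕜) ∈ opResolventSet A ∧ ∀ x : H,
    ∃ h : (∫ s in (0 : ℝ)..t, T s (opResolventClosure A (l : 𝕜) x)) ∈ (partInClosure A).domain,
      S x = (((l : 𝕜) • (∫ s in (0 : ℝ)..t, T s (opResolventClosure A (l : 𝕜) x))
        - partInClosure A ⟨_, h⟩ : domClosure A) : H)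

open Classical in
/-- The integrated semigroup `S_A(t)` generated by `A`. -/
def integratedSemigroup (A : H →ₗ.[𝕜] H) (T : ℝ → domClosure A →L[𝕜] domClosure A)
    (t : ℝ) : H →L[𝕜] H :=
  if h : ∃ S : H →L[𝕜] H, IsIntegratedSemigroupAt A T t S then h.choose else 0

/-- `u` is an integrated solution on `[0, τ]` of `u' = A u + f`, `u 0 = x`. -/
def IsIntegratedSolution (A : H →ₗ.[𝕜] H) (τ : ℝ) (x : H) (f u : ℝ → H) : Prop :=
  ContinuousOn u (Icc 0 τ) ∧ ∀ t ∈ Icc (0 : ℝ) τ,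
    ∃ h : (∫ s in (0 : ℝ)..t, u s) ∈ A.domain,
      u t = x + A ⟨∫ s in (0 : ℝ)..t, u s, h⟩ + ∫ s in (0 : ℝ)..t, f s

end Cauchy

/-- The squared Hilbert-Schmidt norm `∑ₖ ‖B eₖ‖²` (possibly `∞`), computed in an orthonormal
basis `(eₖ)` of `H`; the value does not depend on the basis. -/
def hsNormSq {𝕜 : Type*} [RCLike 𝕜] {H : Type*} [NormedAddCommGroup H] [InnerProductSpace 𝕜 H]
    [CompleteSpace H] (B : H →L[𝕜] H) : ℝ≥0∞ :=
  ∑' e : (exists_hilbertBasis 𝕜 H).choose, ‖B (e : H)‖ₑ ^ 2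

section Noise

variable {𝕜 : Type*} [RCLike 𝕜] {H : Type*} [NormedAddCommGroup H] [InnerProductSpace 𝕜 H]
  {Ω : Type*} [mΩ : MeasurableSpace Ω]

/-- The finite-rank white noise `∑_{j < N} ηⱼ φⱼ(t)`. -/
def finiteRankNoise [NormedSpace ℝ H] (η : ℕ → Ω → ℝ) (φ : ℕ → ℝ → H) (N : ℕ) (o : Ω)
    (t : ℝ) : H :=
  ∑ j ∈ Finset.range N, η j o • φ j t

/-- `Y` is (a version of) `Ẇ(ψ) = ∑ⱼ ηⱼ ⟨φⱼ, ψ⟩`, the value at `ψ ∈ L²(0, τ; H)` of the white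
noise; the series converges in `L²(Ω)`. Here `b` is the orthonormal basis `(φⱼ)`. -/
def IsWhiteNoiseValue {τ : ℝ} (P : Measure Ω) (η : ℕ → Ω → ℝ)
    (b : HilbertBasis ℕ 𝕜 (Lp H 2 (volume.restrict (Icc (0 : ℝ) τ))))
    (ψ : Lp H 2 (volume.restrict (Icc (0 : ℝ) τ))) (Y : Ω → 𝕜) : Prop :=
  Measurable Y ∧ MemLp Y 2 P ∧
    Tendsto (fun N : ℕ => eLpNorm
      (fun o => (∑ j ∈ Finset.range N, (η j o : 𝕜) * inner 𝕜 (b j) ψ) - Y o) 2 P) atTop (𝓝 0)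

/-- The natural (completed) filtration of the white noise: `ℱₜ` is generated by all versions of
the variables `Ẇ(ψ)` with `ψ` vanishing on `(t, τ]`. -/
def noiseFiltration {τ : ℝ} (P : Measure Ω) (η : ℕ → Ω → ℝ)
    (b : HilbertBasis ℕ 𝕜 (Lp H 2 (volume.restrict (Icc (0 : ℝ) τ)))) : Filtration ℝ mΩ where
  seq t := MeasurableSpace.generateFrom
    {s | ∃ (ψ : Lp H 2 (volume.restrict (Icc (0 : ℝ) τ))) (Y : Ω → 𝕜) (B : Set 𝕜),
      (∀ᵐ r ∂(volume.restrict (Icc (0 : ℝ) τ)), t < r → ψ r = 0) ∧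
      IsWhiteNoiseValue P η b ψ Y ∧ MeasurableSet B ∧ s = Y ⁻¹' B}
  mono' := by
    intro t t' htt'
    apply MeasurableSpace.generateFrom_mono
    rintro s ⟨ψ, Y, B, hψ, hY, hB, rfl⟩
    refine ⟨ψ, Y, B, ?_, hY, hB, rfl⟩
    filter_upwards [hψ] with r hr h using hr (lt_of_le_of_lt htt' h)
  le' := by
    intro t
    apply MeasurableSpace.generateFrom_le
    rintro s ⟨ψ, Y, B, hψ, hY, hB, rfl⟩
    exact hY.1 hB

/-- `I` is (a version of) the stochastic integral `∫₀ᵗ Φ(s) dW(s)`, i.e. the limit in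
`L²(Ω; H)` of `∫₀ᵗ Φ(s) dW_N(s) = ∑_{j < N} ηⱼ ∫₀ᵗ Φ(s) φⱼ(s) ds`. -/
def IsStochasticIntegral [NormedSpace ℝ H] (P : Measure Ω) (η : ℕ → Ω → ℝ) (φ : ℕ → ℝ → H)
    (t : ℝ) (Φ : ℝ → H → H) (I : Ω → H) : Prop :=
  (∀ j, IntervalIntegrable (fun s => Φ s (φ j s)) volume 0 t) ∧ MemLp I 2 P ∧
    Tendsto (fun N : ℕ => eLpNorm
      (fun o => (∑ j ∈ Finset.range N, η j o • ∫ s in (0 : ℝ)..t, Φ s (φ j s)) - I o) 2 P)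
      atTop (𝓝 0)

/-- `Z` belongs to `𝒞_𝔽([0, τ]; L²(Ω; H))`: each `Z t` is square integrable and
`ℱₜ`-measurable, and `t ↦ Z t` is continuous in mean square. -/
def MemMeanSquareC (P : Measure Ω) (F : ℝ → MeasurableSpace Ω) (τ : ℝ) (Z : ℝ → Ω → H) : Prop :=
  (∀ t ∈ Icc (0 : ℝ) τ, StronglyMeasurable[F t] (Z t) ∧ MemLp (Z t) 2 P) ∧
    ∀ t ∈ Icc (0 : ℝ) τ,
      Tendsto (fun s => eLpNorm (Z s - Z t) 2 P) (𝓝[Icc 0 τ] t) (𝓝 0)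

variable [NormedSpace ℝ H] [IsScalarTower ℝ 𝕜 H]

/-- Mild solution of `dX = A X dt + dW`, `X 0 = ξ`: almost surely
`X t = T t ξ + ∫₀ᵗ S_A'(t - s) dW(s)`, for every `t ∈ [0, τ]`. -/
def IsMildSolution (P : Measure Ω) (η : ℕ → Ω → ℝ) (φ : ℕ → ℝ → H)
    (A : H →ₗ.[𝕜] H) (T : ℝ → domClosure A →L[𝕜] domClosure A) (τ : ℝ) (ξ : domClosure A)
    (X : ℝ → Ω → H) : Prop :=
  ∀ t ∈ Icc (0 : ℝ) τ, ∃ I : Ω → H,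
    IsStochasticIntegral P η φ t (fun s x => deriv (integratedSemigroup A T) (t - s) x) I ∧
    ∀ᵐ o ∂P, X t o = (T t ξ : H) + I o

/-- Integrated solution of `dX = A X dt + dW`, `X 0 = ξ`. As `W(t)` has no values in `H`, the
identity `X t = ξ + A ∫₀ᵗ X s ds + W(t)` is required after application of the injective operators
`R(l, A)`, `l > w`: almost surely
`R(l, A) X t = R(l, A) ξ + A R(l, A) ∫₀ᵗ X s ds + ∫₀ᵗ R(l, A) dW(s)`,
where `∫₀ᵗ X s ds` is the integral of a continuous `L²(Ω; H)`-valued function. -/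
def IsIntegratedSolutionWithNoise (P : Measure Ω) (η : ℕ → Ω → ℝ) (φ : ℕ → ℝ → H)
    (A : H →ₗ.[𝕜] H) (w τ : ℝ) (ξ : domClosure A) (X : ℝ → Ω → H) : Prop :=
  ∃ Xc : ℝ → Lp H 2 P, ContinuousOn Xc (Icc 0 τ) ∧ (∀ s ∈ Icc (0 : ℝ) τ, Xc s =ᵐ[P] X s) ∧
    ∀ l : ℝ, w < l → ∀ t ∈ Icc (0 : ℝ) τ, ∃ J : Ω → H,
      IsStochasticIntegral P η φ t (fun _ x => opResolvent A (l : 𝕜) x) J ∧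
      ∀ᵐ o ∂P, opResolvent A (l : 𝕜) (X t o) = opResolvent A (l : 𝕜) ξ
        + A ⟨opResolvent A (l : 𝕜) ((∫ s in (0 : ℝ)..t, Xc s : Lp H 2 P) o),
            opResolvent_mem_domain A _ _⟩
        + J o

end Noise

end

/-! Write `R(l)` for the resolvent of `A`. Analyticity enters only through norm differentiability of
`T` on `(0, ∞)`: it makes `V(t) = (l - A₀) T(t) R(l) = (l T(t) - T'(t)) R(l)` a bounded operator
from `H` to `H₀`, and `V` is the derivative of the integrated semigroup for `t > 0`. Since `R(m)` is
injective, the relation `R(m) V(t) = T(t) R(m)` determines `V(t)` and shows that it does not depend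
on `l`. The norm of `V` may blow up at `0`, but the Hilbert-Schmidt hypothesis makes it square
integrable.

For continuous `f` the unique integrated solution is `T(t) ξ + ∫₀ᵗ V(t - s) f(s) ds`. Existence is
the fundamental theorem of calculus for `s ↦ T(s) R(m) F(t - s)` with `F = ∫ f`
(`convolution_resolvent_identity`). Uniqueness holds because `T(t - s) R(m) ∫₀ˢ v` is constant in
`s` when `v` is the difference of two solutions (`eq_zero_of_integrated_homogeneous`).

Consequently `X_N(t) = T(t) ξ + ∑_{j < N} ηⱼ cⱼ(t)` with `cⱼ(t) = ∫₀ᵗ V(t - s) φⱼ(s) ds`. Parseval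
(`tsum_enorm_integral_sq`) gives `∑ⱼ ‖cⱼ(t)‖² = ∫₀ᵗ ‖V(r)‖² dr` in Hilbert-Schmidt norm. The `ηⱼ`
are orthonormal in `L²(Ω)`, so this is the variance of the limiting series; being continuous in `t`,
it is approached uniformly by Dini's theorem (`eventually_norm_series_sub_le`).

The limit inherits the integrated equation, since after application of `R(m)` only bounded operators
and time integrals occur. It is adapted because its pairing with `h` is the white noise at `V(t -
·)* h`, which vanishes after time `t`. Finally `T(t - s) l R(l) = l R(l) V(t - s)`, so the
regularized stochastic integral is `l R(l)` applied to the stochastic convolution; as the latter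
lives in `H₀`, where `l R(l) y → y`, the limit exists for every outcome, and in mean square by
domination. -/

set_option linter.unusedSectionVars false

/-! ### Calculus for `𝕜`-linear operators depending on a real parameter. -/

section CLMCalculus

variable {𝕜 : Type*} [RCLike 𝕜] {E F : Type*}
  [NormedAddCommGroup E] [NormedSpace 𝕜 E] [NormedSpace ℝ E] [IsScalarTower ℝ 𝕜 E]
  [NormedAddCommGroup F] [NormedSpace 𝕜 F] [NormedSpace ℝ F] [IsScalarTower ℝ 𝕜 F]

/-- Product rule for a family of `𝕜`-linear operators depending on a real parameter. -/
theorem HasDerivAt.clm_apply_of_real {c : ℝ → E →L[𝕜] F} {c' : E →L[𝕜] F} {u : ℝ → E} {u' : E}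
    {t : ℝ} (hc : HasDerivAt c c' t) (hu : HasDerivAt u u' t) :
    HasDerivAt (fun s => c s (u s)) (c' (u t) + c t u') t := by
  have h := (ContinuousLinearMap.restrictScalarsL 𝕜 E F ℝ ℝ).hasFDerivAt.comp_hasDerivAt t hc
  exact h.clm_apply hu

theorem HasDerivAt.clm_apply_const {c : ℝ → E →L[𝕜] F} {c' : E →L[𝕜] F} {t : ℝ}
    (hc : HasDerivAt c c' t) (x : E) : HasDerivAt (fun s => c s x) (c' x) t := by
  simpa using hc.clm_apply_of_real (hasDerivAt_const t x)

theorem intervalIntegral_clm_apply [CompleteSpace F] {c : ℝ → E →L[𝕜] F} {a b : ℝ}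
    (hc : IntervalIntegrable c volume a b) (x : E) :
    (∫ s in a..b, c s) x = ∫ s in a..b, c s x := by
  have h := ((ContinuousLinearMap.apply 𝕜 F x).restrictScalars ℝ).intervalIntegral_comp_comm hc
  simpa using h.symm

theorem ContinuousLinearMap.intervalIntegral_comp_comm_of_real [CompleteSpace E] [CompleteSpace F]
    (L : E →L[𝕜] F) {u : ℝ → E} {a b : ℝ} (hu : IntervalIntegrable u volume a b) :
    ∫ s in a..b, L (u s) = L (∫ s in a..b, u s) :=
  (L.restrictScalars ℝ).intervalIntegral_comp_comm hu

theorem IntervalIntegrable.clm_comp_of_real (L : E →L[𝕜] F) {u : ℝ → E} {a b : ℝ}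
    (hu : IntervalIntegrable u volume a b) : IntervalIntegrable (fun s => L (u s)) volume a b :=
  ⟨(L.restrictScalars ℝ).integrable_comp hu.1, (L.restrictScalars ℝ).integrable_comp hu.2⟩

theorem IntervalIntegrable.clm_apply_const {c : ℝ → E →L[𝕜] F} {a b : ℝ}
    (hc : IntervalIntegrable c volume a b) (x : E) :
    IntervalIntegrable (fun s => c s x) volume a b :=
  hc.clm_comp_of_real (ContinuousLinearMap.apply 𝕜 F x)

end CLMCalculus

/-! ### Strongly continuous semigroups that are norm differentiable for positive times. -/

section Semigroup

variable {𝕜 : Type*} [RCLike 𝕜] {E : Type*} [NormedAddCommGroup E] [NormedSpace 𝕜 E]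
  [NormedSpace ℝ E] [IsScalarTower ℝ 𝕜 E] {T : ℝ → E →L[𝕜] E}

theorem openSector_ofReal_mem {θ t : ℝ} (hθ : 0 < θ) (ht : 0 < t) : (t : ℂ) ∈ openSector θ := by
  refine ⟨by exact_mod_cast ht.ne', ?_⟩
  rw [Complex.arg_ofReal_of_nonneg ht.le]
  simpa using hθ

/-- An analytic semigroup is differentiable in operator norm on `(0, ∞)`. -/
theorem IsAnalyticSemigroup.differentiableAt (hT : IsAnalyticSemigroup T) {t : ℝ} (ht : 0 < t) :
    DifferentiableAt ℝ T t := by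
  obtain ⟨θ, hθ, -, U, V, hUV, -, hreal, -⟩ := hT
  obtain ⟨a, b, hU, -⟩ := hUV t (openSector_ofReal_mem hθ ht)
  have h : HasDerivAt (fun s : ℝ => U (s : ℂ)) _ t :=
    hU.comp_hasDerivAt t (Complex.ofRealCLM.hasDerivAt)
  refine (h.congr_of_eventuallyEq ?_).differentiableAt
  filter_upwards [eventually_gt_nhds ht] with s hs using (hreal s hs).1.symm

variable (h0 : IsC0Semigroup T) (hd : ∀ t : ℝ, 0 < t → DifferentiableAt ℝ T t)

include h0 in
theorem IsC0Semigroup.add_apply {s t : ℝ} (hs : 0 ≤ s) (ht : 0 ≤ t) (x : E) :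
    T (s + t) x = T s (T t x) := by
  rw [h0.add s t hs ht]; rfl

include h0 hd in
theorem IsC0Semigroup.continuousOn_apply (x : E) : ContinuousOn (fun t => T t x) (Ici 0) := by
  intro t ht
  rcases eq_or_lt_of_le (mem_Ici.1 ht) with rfl | ht
  · rw [← continuousWithinAt_Ioi_iff_Ici, ContinuousWithinAt, h0.zero]
    exact h0.strongCont x
  · exact ((hd t ht).hasDerivAt.clm_apply_const x).continuousAt.continuousWithinAt

include h0 hd in
theorem IsC0Semigroup.exists_norm_le [CompleteSpace E] (τ : ℝ) :
    ∃ M : ℝ, 0 < M ∧ ∀ t ∈ Icc 0 τ, ‖T t‖ ≤ M := by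
  have h : ∃ C, ∀ t : Icc (0 : ℝ) τ, ‖T t‖ ≤ C := by
    apply banach_steinhaus
    intro x
    obtain ⟨C, hC⟩ := isCompact_Icc.exists_bound_of_continuousOn
      ((h0.continuousOn_apply hd x).mono (Icc_subset_Ici_self : Icc 0 τ ⊆ Ici 0))
    exact ⟨C, fun t => hC t t.2⟩
  obtain ⟨C, hC⟩ := h
  exact ⟨max C 1, by positivity, fun t ht => (hC ⟨t, ht⟩).trans (le_max_left _ _)⟩

include hd in
theorem continuousOn_Ioi_of_differentiableAt : ContinuousOn T (Ioi 0) := fun t ht =>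
  (hd t ht).continuousAt.continuousWithinAt

include h0 hd in
theorem IsC0Semigroup.intervalIntegrable [CompleteSpace E] {t : ℝ} (ht : 0 ≤ t) :
    IntervalIntegrable T volume 0 t := by
  obtain ⟨M, -, hM⟩ := h0.exists_norm_le hd t
  rw [intervalIntegrable_iff_integrableOn_Ioc_of_le ht]
  refine IntegrableOn.of_bound (by simp) ?_ M ?_
  · exact ((continuousOn_Ioi_of_differentiableAt hd).mono Ioc_subset_Ioi_self).aestronglyMeasurable
      measurableSet_Ioc
  · filter_upwards [ae_restrict_mem measurableSet_Ioc] with s hs using hM s ⟨hs.1.le, hs.2⟩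

include h0 hd in
/-- Joint continuity of a strongly continuous semigroup. -/
theorem IsC0Semigroup.tendsto_apply [CompleteSpace E] {α : Type*} {f : Filter α} {r : α → ℝ}
    {u : α → E} {r₀ : ℝ} {x : E} (hr : Tendsto r f (𝓝[Ici 0] r₀)) (hr₀ : 0 ≤ r₀)
    (hu : Tendsto u f (𝓝 x)) : Tendsto (fun a => T (r a) (u a)) f (𝓝 (T r₀ x)) := by
  obtain ⟨M, -, hM⟩ := h0.exists_norm_le hd (r₀ + 1)
  have h1 : Tendsto (fun a => T (r a) x) f (𝓝 (T r₀ x)) :=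
    (h0.continuousOn_apply hd x r₀ hr₀).tendsto.comp hr
  have h2 : Tendsto (fun a => T (r a) (u a - x)) f (𝓝 0) := by
    have h3 : Tendsto (fun a => M * ‖u a - x‖) f (𝓝 0) := by
      simpa using (tendsto_iff_norm_sub_tendsto_zero.1 hu).const_mul M
    refine squeeze_zero_norm' ?_ h3
    have h4 : ∀ᶠ a in f, r a ∈ Ici (0 : ℝ) := hr self_mem_nhdsWithin
    have h5 : ∀ᶠ a in f, r a < r₀ + 1 :=
      (hr.mono_right nhdsWithin_le_nhds).eventually (eventually_lt_nhds (by linarith))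
    filter_upwards [h4, h5] with a ha hb
    exact (T (r a)).le_of_opNorm_le (hM _ ⟨ha, hb.le⟩) _
  simpa using h1.add h2

variable {B : E →ₗ.[𝕜] E} (hB : IsSemigroupGenerator T B)

include h0 hd hB in
/-- For `t > 0` the operator `T t` maps into the domain of the generator. -/
theorem IsSemigroupGenerator.apply_mem {t : ℝ} (ht : 0 < t) (x : E) :
    ∃ h : T t x ∈ B.domain, B ⟨T t x, h⟩ = deriv T t x := by
  rw [← hB]
  have h1 := ((hd t ht).hasDerivAt.clm_apply_const x).tendsto_slope_zero_right
  refine h1.congr' ?_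
  filter_upwards [self_mem_nhdsWithin] with s hs
  rw [add_comm t s, h0.add_apply (le_of_lt hs) ht.le]

include h0 hd hB in
-- The derivative exists, so it can be computed from the right, and the right difference quotient at
-- `t` is `T t` applied to the one at `0`.
theorem IsSemigroupGenerator.deriv_apply {t : ℝ} (ht : 0 < t) (x : B.domain) :
    deriv T t x = T t (B x) := by
  have h1 := ((hd t ht).hasDerivAt.clm_apply_const (x : E)).tendsto_slope_zero_right
  have h2 : Tendsto (fun s : ℝ => s⁻¹ • (T s x - x)) (𝓝[>] 0) (𝓝 (B x)) :=
    (hB x (B x)).2 ⟨x.2, rfl⟩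
  have h3 := ((T t).continuous.tendsto _).comp h2
  refine tendsto_nhds_unique h1 (h3.congr' ?_)
  filter_upwards [self_mem_nhdsWithin] with s hs
  simp only [Function.comp_apply]
  rw [(T t).map_smul_of_tower, h0.add_apply ht.le (le_of_lt hs)]
  simp

include h0 hd hB in
/-- Fundamental theorem of calculus for an orbit starting in the domain of the generator. -/
theorem IsSemigroupGenerator.integral_apply [CompleteSpace E] {t : ℝ} (ht : 0 ≤ t)
    (x : B.domain) : ∫ s in (0 : ℝ)..t, T s (B x) = T t x - x := by
  have h := intervalIntegral.integral_eq_sub_of_hasDerivAt_of_le (f := fun s => T s (x : E))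
    (f' := fun s => T s (B x)) ht
    ((h0.continuousOn_apply hd (x : E)).mono Icc_subset_Ici_self) (fun s hs => by
      rw [← hB.deriv_apply h0 hd hs.1 x]
      exact (hd s hs.1).hasDerivAt.clm_apply_const (x : E))
    ((h0.intervalIntegrable hd ht).clm_apply_const (B x))
  simpa [h0.zero] using h

end Semigroup

/-! ### The resolvent of `A` and of its part in `H₀`. -/

section Resolvent

variable {𝕜 : Type*} [RCLike 𝕜] {H : Type*} [NormedAddCommGroup H] [InnerProductSpace 𝕜 H]
  {A : H →ₗ.[𝕜] H} {l m : 𝕜}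

theorem isResolventAt_opResolvent (hl : l ∈ opResolventSet A) :
    IsResolventAt A l (opResolvent A l) := by
  have h : ∃ R : H →L[𝕜] H, IsResolventAt A l R := hl
  unfold opResolvent
  rw [dif_pos h]
  exact h.choose_spec

theorem apply_opResolvent (hl : l ∈ opResolventSet A) (x : H) :
    A ⟨opResolvent A l x, opResolvent_mem_domain A l x⟩ = l • opResolvent A l x - x := by
  obtain ⟨h, hx⟩ := (isResolventAt_opResolvent hl).1 x
  rw [eq_sub_iff_add_eq, ← eq_sub_iff_add_eq', hx]

/-- Membership in the graph of the unbounded `A` becomes an equation for one bounded operator, which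
survives integration and limits. Domain questions below are settled in this form. -/
theorem exists_apply_eq_iff (hl : l ∈ opResolventSet A) {z v : H} :
    (∃ h : z ∈ A.domain, A ⟨z, h⟩ = v) ↔ z = opResolvent A l (l • z - v) := by
  constructor
  · rintro ⟨h, rfl⟩
    exact ((isResolventAt_opResolvent hl).2 ⟨z, h⟩).symm
  · intro h
    have h1 : z ∈ A.domain := h ▸ opResolvent_mem_domain A l _
    refine ⟨h1, ?_⟩
    have h2 := apply_opResolvent hl (l • z - v)
    simp only [← h] at h2
    simpa using h2

theorem opResolvent_injective (hl : l ∈ opResolventSet A) :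
    Function.Injective (opResolvent A l) := by
  intro x y hxy
  have hx := apply_opResolvent hl x
  have hy := apply_opResolvent hl y
  simp only [hxy] at hx
  simpa using hx.symm.trans hy

@[simp]
theorem coe_opResolventClosure (x : H) :
    ((opResolventClosure A l x : domClosure A) : H) = opResolvent A l x := rfl

/-- The extra condition `A z ∈ H₀` in the domain of the part is automatic, because the prescribed
value `v` already lies in `H₀`. -/
theorem exists_partInClosure_apply_eq_iff (hl : l ∈ opResolventSet A) {z v : domClosure A} :
    (∃ h : z ∈ (partInClosure A).domain, partInClosure A ⟨z, h⟩ = v) ↔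
      z = opResolventClosure A l (((l • z - v : domClosure A) : H)) := by
  rw [← Subtype.coe_inj, coe_opResolventClosure, Submodule.coe_sub, Submodule.coe_smul,
    ← exists_apply_eq_iff hl]
  constructor
  · rintro ⟨h, rfl⟩
    exact ⟨h.choose, rfl⟩
  · rintro ⟨h, h'⟩
    exact ⟨⟨h, h' ▸ v.2⟩, Subtype.ext h'⟩

/-- The resolvent equation. -/
theorem opResolvent_sub (hl : l ∈ opResolventSet A) (hm : m ∈ opResolventSet A) (x : H) :
    opResolvent A m ((l - m) • opResolvent A l x) + opResolvent A l x = opResolvent A m x := by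
  have h := (isResolventAt_opResolvent hm).2 ⟨_, opResolvent_mem_domain A l x⟩
  rw [apply_opResolvent hl] at h
  change opResolvent A m (m • opResolvent A l x - (l • opResolvent A l x - x)) =
    opResolvent A l x at h
  refine (congrArg (_ + ·) h.symm).trans ?_
  rw [← map_add]
  congr 1
  simp only [sub_smul]
  abel

end Resolvent

/-! ### The integrated semigroup and its derivative. -/

noncomputable section IntegratedSemigroup

variable {𝕜 : Type*} [RCLike 𝕜] {H : Type*} [NormedAddCommGroup H] [InnerProductSpace 𝕜 H]
  [NormedSpace ℝ H] [IsScalarTower ℝ 𝕜 H]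
  {A : H →ₗ.[𝕜] H} {T : ℝ → domClosure A →L[𝕜] domClosure A} {l m : 𝕜}

/-- The operator `(l I - A₀) T(t) R(l, A)`, which is the derivative of the integrated semigroup
for `t > 0`. -/
def resolventOrbit (A : H →ₗ.[𝕜] H) (T : ℝ → domClosure A →L[𝕜] domClosure A) (l : 𝕜) (t : ℝ) :
    H →L[𝕜] domClosure A :=
  (l • T t - deriv T t).comp (opResolventClosure A l)

/-- The operator `(l I - A₀) ∫₀ᵗ T(s) ds R(l, A)` with values in `H₀`. -/
def resolventIntegral (A : H →ₗ.[𝕜] H) (T : ℝ → domClosure A →L[𝕜] domClosure A) (l : 𝕜)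
    (t : ℝ) : H →L[𝕜] domClosure A :=
  (l • (∫ s in (0 : ℝ)..t, T s) - T t + ContinuousLinearMap.id 𝕜 _).comp (opResolventClosure A l)

theorem resolventOrbit_apply (t : ℝ) (x : H) :
    resolventOrbit A T l t x =
      l • T t (opResolventClosure A l x) - deriv T t (opResolventClosure A l x) := rfl

variable [CompleteSpace H] (h0 : IsC0Semigroup T) (hd : ∀ t : ℝ, 0 < t → DifferentiableAt ℝ T t)
  (hB : IsSemigroupGenerator T (partInClosure A))

-- For `t > 0` the generator maps `T(t) R y` to `T(t) A₀ R y = T(t) (l R y - y)`; the graph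
-- criterion turns this into the commutation relation.
include h0 hd hB in
theorem semigroup_apply_opResolventClosure (hl : l ∈ opResolventSet A) {t : ℝ} (ht : 0 ≤ t)
    (x : domClosure A) :
    T t (opResolventClosure A l x) = opResolventClosure A l (T t x : domClosure A) := by
  rcases ht.eq_or_lt with rfl | ht
  · simp [h0.zero]
  obtain ⟨h1, h2⟩ := (exists_partInClosure_apply_eq_iff hl
    (z := opResolventClosure A l x) (v := l • opResolventClosure A l x - x)).2 (by simp)
  obtain ⟨h3, h4⟩ := hB.apply_mem h0 hd ht (opResolventClosure A l (x : H))
  rw [hB.deriv_apply h0 hd ht ⟨_, h1⟩, h2] at h4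
  have h5 := (exists_partInClosure_apply_eq_iff hl).1 ⟨h3, h4⟩
  simpa using h5

-- By injectivity of the resolvent this intertwining determines the orbit operator without reference
-- to `A₀`.
include h0 hd hB in
theorem opResolventClosure_resolventOrbit (hl : l ∈ opResolventSet A) {t : ℝ} (ht : 0 < t)
    (x : H) :
    opResolventClosure A l (resolventOrbit A T l t x : domClosure A) =
      T t (opResolventClosure A l x) :=
  ((exists_partInClosure_apply_eq_iff hl).1
    (hB.apply_mem h0 hd ht (opResolventClosure A l x))).symm

include h0 hd hB in
/-- `A₀ ∫₀ᵗ T(s) y ds = T(t) y - y`. -/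
theorem partInClosure_integral (hl : l ∈ opResolventSet A) {t : ℝ} (ht : 0 ≤ t)
    (y : domClosure A) :
    ∃ h : (∫ s in (0 : ℝ)..t, T s y) ∈ (partInClosure A).domain,
      partInClosure A ⟨_, h⟩ = T t y - y := by
  rw [exists_partInClosure_apply_eq_iff hl]
  have hint := h0.intervalIntegrable hd ht
  set R : domClosure A →L[𝕜] domClosure A := (opResolventClosure A l).comp (domClosure A).subtypeL
    with hR
  have hRa : ∀ z : domClosure A, opResolventClosure A l (z : H) = R z := fun z => rfl
  have hcomm : ∀ s ∈ Icc (0 : ℝ) t, T s (R y) = R (T s y) := fun s hs =>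
    semigroup_apply_opResolventClosure h0 hd hB hl hs.1 y
  -- `y` itself need not lie in the domain, but `R y` does; the fundamental theorem is applied to
  -- the orbit of `R y`, and commutation then pulls `R` out of the integral.
  obtain ⟨h1, h2⟩ := (exists_partInClosure_apply_eq_iff hl
    (z := R y) (v := l • R y - y)).2 (by simp [hRa])
  have h3 := hB.integral_apply h0 hd ht ⟨_, h1⟩
  rw [h2] at h3
  have h4 : ∫ s in (0 : ℝ)..t, T s (l • R y - y) =
      l • R (∫ s in (0 : ℝ)..t, T s y) - ∫ s in (0 : ℝ)..t, T s y := by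
    rw [← R.intervalIntegral_comp_comm_of_real (hint.clm_apply_const y),
      ← intervalIntegral_clm_apply hint, map_sub, map_smul,
      intervalIntegral_clm_apply hint, intervalIntegral_clm_apply hint]
    congr 2
    refine intervalIntegral.integral_congr fun s hs => ?_
    rw [uIcc_of_le ht] at hs
    exact hcomm s hs
  rw [h4] at h3
  rw [hRa, map_sub, map_smul, map_sub, ← hcomm t ⟨ht, le_rfl⟩, ← h3]
  simp

include h0 hd in
theorem hasDerivAt_resolventIntegral {t : ℝ} (ht : 0 < t) :
    HasDerivAt (resolventIntegral A T l) (resolventOrbit A T l t) t := by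
  have hT : ContinuousOn T (Ioi 0) := continuousOn_Ioi_of_differentiableAt hd
  have h1 : HasDerivAt (fun u => ∫ s in (0 : ℝ)..u, T s) (T t) t :=
    intervalIntegral.integral_hasDerivAt_right (h0.intervalIntegrable hd ht.le)
      (hT.stronglyMeasurableAtFilter isOpen_Ioi t ht) (hd t ht).continuousAt
  have h2 : HasDerivAt (fun u => l • (∫ s in (0 : ℝ)..u, T s) - T u +
      ContinuousLinearMap.id 𝕜 (domClosure A)) (l • T t - deriv T t) t :=
    ((h1.const_smul l).sub (hd t ht).hasDerivAt).add_const _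
  exact (((ContinuousLinearMap.compL 𝕜 H (domClosure A) (domClosure A)).flip
    (opResolventClosure A l)).restrictScalars ℝ).hasFDerivAt.comp_hasDerivAt t h2

-- Since `A₀ ∫₀ᵗ T(s) y ds = T(t) y - y`, the unbounded factor `l - A₀` is absorbed into the bounded
-- expression defining `resolventIntegral`, which can be differentiated in operator norm.
include h0 hd hB in
theorem resolventIntegral_apply (hl : l ∈ opResolventSet A) {t : ℝ} (ht : 0 ≤ t) (x : H) :
    ∃ h : (∫ s in (0 : ℝ)..t, T s (opResolventClosure A l x)) ∈ (partInClosure A).domain,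
      resolventIntegral A T l t x = l • (∫ s in (0 : ℝ)..t, T s (opResolventClosure A l x))
        - partInClosure A ⟨_, h⟩ := by
  obtain ⟨h, h'⟩ := partInClosure_integral h0 hd hB hl ht (opResolventClosure A l x)
  refine ⟨h, ?_⟩
  rw [h', ← intervalIntegral_clm_apply (h0.intervalIntegrable hd ht)]
  simp [resolventIntegral]
  abel

-- The right-hand side no longer contains `l`, so injectivity of `R(m, A)` gives independence of
-- `l`. The computation rests on the resolvent equation.
include h0 hd hB in
theorem opResolventClosure_resolventIntegral (hl : l ∈ opResolventSet A)
    (hm : m ∈ opResolventSet A) {t : ℝ} (ht : 0 ≤ t) (x : H) :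
    opResolventClosure A m (resolventIntegral A T l t x : domClosure A) =
      ∫ s in (0 : ℝ)..t, T s (opResolventClosure A m x) := by
  have hint := h0.intervalIntegrable hd ht
  obtain ⟨v, h', h2⟩ : ∃ v, resolventIntegral A T l t x =
      l • (∫ s in (0 : ℝ)..t, T s (opResolventClosure A l x)) - v ∧
      (∫ s in (0 : ℝ)..t, T s (opResolventClosure A l x)) = opResolventClosure A m
        ((m • (∫ s in (0 : ℝ)..t, T s (opResolventClosure A l x)) - v : domClosure A) : H) := by
    obtain ⟨h, h'⟩ := resolventIntegral_apply h0 hd hB hl ht x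
    exact ⟨_, h', (exists_partInClosure_apply_eq_iff hm).1 ⟨h, rfl⟩⟩
  set z := ∫ s in (0 : ℝ)..t, T s (opResolventClosure A l x) with hz
  set R : domClosure A →L[𝕜] domClosure A := (opResolventClosure A m).comp (domClosure A).subtypeL
    with hR
  have hRa : ∀ z : domClosure A, opResolventClosure A m (z : H) = R z := fun z => rfl
  have h3 : R ((l - m) • z) + z = ∫ s in (0 : ℝ)..t, T s (opResolventClosure A m x) := by
    have h4 : opResolventClosure A m x = R ((l - m) • opResolventClosure A l x)
        + opResolventClosure A l x := Subtype.ext (opResolvent_sub hl hm x).symm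
    rw [h4, ← intervalIntegral_clm_apply hint, map_add, intervalIntegral_clm_apply hint,
      intervalIntegral_clm_apply hint, ← hz]
    congr 1
    have h5 : ∫ s in (0 : ℝ)..t, T s (R ((l - m) • opResolventClosure A l x)) =
        ∫ s in (0 : ℝ)..t, R (T s ((l - m) • opResolventClosure A l x)) := by
      refine intervalIntegral.integral_congr fun s hs => ?_
      rw [uIcc_of_le ht] at hs
      exact semigroup_apply_opResolventClosure h0 hd hB hm hs.1
        ((l - m) • opResolventClosure A l x)
    rw [h5, R.intervalIntegral_comp_comm_of_real (hint.clm_apply_const _)]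
    congr 1
    rw [← intervalIntegral_clm_apply hint, map_smul, intervalIntegral_clm_apply hint]
  rw [hRa] at h2
  rw [h', ← h3, hRa]
  refine Eq.trans ?_ (congrArg (R ((l - m) • z) + ·) h2.symm)
  rw [← map_add, sub_smul]
  congr 1
  abel

include h0 hd hB in
theorem resolventIntegral_congr (hl : l ∈ opResolventSet A) (hm : m ∈ opResolventSet A) {t : ℝ}
    (ht : 0 ≤ t) : resolventIntegral A T l t = resolventIntegral A T m t := by
  ext x
  apply opResolvent_injective hm
  have h := (opResolventClosure_resolventIntegral h0 hd hB hl hm ht x).trans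
    (opResolventClosure_resolventIntegral h0 hd hB hm hm ht x).symm
  exact congrArg Subtype.val h

variable {w : ℝ} (hw : ∀ l : ℝ, w < l → (l : 𝕜) ∈ opResolventSet A)

-- Existence holds for every large parameter by independence of `l`; the defining formula at a
-- single such parameter already fixes the chosen operator.
include h0 hd hB hw in
theorem integratedSemigroup_eq {l : ℝ} (hl : w < l) {t : ℝ} (ht : 0 ≤ t) :
    integratedSemigroup A T t = (domClosure A).subtypeL.comp (resolventIntegral A T (l : 𝕜) t) := by
  have key : ∃ S : H →L[𝕜] H, IsIntegratedSemigroupAt A T t S := by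
    refine ⟨(domClosure A).subtypeL.comp (resolventIntegral A T (l : 𝕜) t), ?_⟩
    filter_upwards [eventually_gt_atTop w] with m hm
    refine ⟨hw m hm, fun x => ?_⟩
    rw [resolventIntegral_congr h0 hd hB (hw l hl) (hw m hm) ht]
    obtain ⟨h, h'⟩ := resolventIntegral_apply h0 hd hB (hw m hm) ht x
    exact ⟨h, congrArg Subtype.val h'⟩
  unfold integratedSemigroup
  rw [dif_pos key]
  obtain ⟨m, hm, -, h⟩ := ((eventually_gt_atTop w).and key.choose_spec).exists
  ext x
  obtain ⟨h1, h2⟩ := h x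
  obtain ⟨h3, h4⟩ := resolventIntegral_apply h0 hd hB (hw m hm) ht x
  rw [resolventIntegral_congr h0 hd hB (hw l hl) (hw m hm) ht, h2]
  exact (congrArg Subtype.val h4).symm

include h0 hd hB hw in
theorem hasDerivAt_integratedSemigroup {l : ℝ} (hl : w < l) {t : ℝ} (ht : 0 < t) :
    HasDerivAt (integratedSemigroup A T)
      ((domClosure A).subtypeL.comp (resolventOrbit A T (l : 𝕜) t)) t := by
  have h1 := ((ContinuousLinearMap.compL 𝕜 H (domClosure A) H
    (domClosure A).subtypeL).restrictScalars ℝ).hasFDerivAt.comp_hasDerivAt t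
    (hasDerivAt_resolventIntegral (A := A) (l := (l : 𝕜)) h0 hd ht)
  refine h1.congr_of_eventuallyEq ?_
  filter_upwards [eventually_gt_nhds ht] with s hs
  exact integratedSemigroup_eq h0 hd hB hw hl hs.le

include h0 hd hB hw in
theorem deriv_integratedSemigroup_apply {l : ℝ} (hl : w < l) {t : ℝ} (ht : 0 < t) (x : H) :
    deriv (integratedSemigroup A T) t x = (resolventOrbit A T (l : 𝕜) t x : domClosure A) := by
  rw [(hasDerivAt_integratedSemigroup h0 hd hB hw hl ht).deriv]; rfl

include h0 hd hB hw in
theorem resolventOrbit_congr {l m : ℝ} (hl : w < l) (hm : w < m) {t : ℝ} (ht : 0 < t) (x : H) :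
    resolventOrbit A T (l : 𝕜) t x = resolventOrbit A T (m : 𝕜) t x :=
  Subtype.ext ((deriv_integratedSemigroup_apply h0 hd hB hw hl ht x).symm.trans
    (deriv_integratedSemigroup_apply h0 hd hB hw hm ht x))

end IntegratedSemigroup

/-! ### Strong convergence `l R(l, A) y → y` on `H₀`. -/

section ResolventLimit

variable {𝕜 : Type*} [RCLike 𝕜] {H : Type*} [NormedAddCommGroup H] [InnerProductSpace 𝕜 H]
  [NormedSpace ℝ H] [IsScalarTower ℝ 𝕜 H]
  {A : H →ₗ.[𝕜] H} {T : ℝ → domClosure A →L[𝕜] domClosure A} {w p : ℝ}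

theorem AlmostSectorialAssumption.tendsto_norm_opResolvent
    (hA : AlmostSectorialAssumption A T w p) :
    Tendsto (fun l : ℝ => ‖opResolvent A (l : 𝕜)‖) atTop (𝓝 0) := by
  obtain ⟨C, hC, hCt⟩ := exists_between hA.limsup_lt_top
  have hp : 0 < 1 / p := by have := hA.one_le; positivity
  have h1 : Tendsto (fun l : ℝ => C.toReal * l ^ (-(1 / p))) atTop (𝓝 0) := by
    simpa using (tendsto_rpow_neg_atTop hp).const_mul C.toReal
  refine squeeze_zero' (Eventually.of_forall fun l => norm_nonneg _) ?_ h1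
  filter_upwards [eventually_lt_of_limsup_lt hC, eventually_gt_atTop 0] with l hl hl0
  have h2 : l ^ (1 / p) * ‖opResolvent A (l : 𝕜)‖ ≤ C.toReal :=
    (ENNReal.ofReal_le_iff_le_toReal hCt.ne).1 hl.le
  rw [Real.rpow_neg hl0.le, ← div_eq_mul_inv, le_div_iff₀ (Real.rpow_pos_of_pos hl0 _), mul_comm]
  exact h2

variable [CompleteSpace H] (h0 : IsC0Semigroup T) (hd : ∀ t : ℝ, 0 < t → DifferentiableAt ℝ T t)
  (hB : IsSemigroupGenerator T (partInClosure A))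
  (hw : ∀ l : ℝ, w < l → (l : 𝕜) ∈ opResolventSet A)

-- With `z = R(l, A) y` one has `A₀ z = l z - y`, so `e^{-ls} T(s) z` has derivative `-e^{-ls} T(s)
-- y`. Stopping this Laplace transform at time `1` avoids any growth bound for `T`.
include h0 hd hB in
theorem opResolventClosure_sub_exp_smul {l : ℝ} (hl : (l : 𝕜) ∈ opResolventSet A)
    (y : domClosure A) :
    opResolventClosure A (l : 𝕜) y - Real.exp (-l) • T 1 (opResolventClosure A (l : 𝕜) y) =
      ∫ s in (0 : ℝ)..1, Real.exp (-l * s) • T s y := by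
  set z := opResolventClosure A (l : 𝕜) (y : H) with hz
  obtain ⟨h1, h2⟩ := (exists_partInClosure_apply_eq_iff hl
    (z := z) (v := (l : 𝕜) • z - y)).2 (by simp [hz])
  have hcont : Continuous fun s : ℝ => Real.exp (-l * s) := by fun_prop
  have h := intervalIntegral.integral_eq_sub_of_hasDerivAt_of_le
    (f := fun s => Real.exp (-l * s) • T s z)
    (f' := fun s => -(Real.exp (-l * s) • T s y)) zero_le_one
    (hcont.continuousOn.smul ((h0.continuousOn_apply hd z).mono Icc_subset_Ici_self))
    (fun s hs => by
      have h3 : HasDerivAt (fun s => T s z) (T s ((l : 𝕜) • z - y)) s := by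
        have h4 := hB.deriv_apply h0 hd hs.1 ⟨z, h1⟩
        rw [h2] at h4
        rw [← h4]
        exact (hd s hs.1).hasDerivAt.clm_apply_const z
      have h5 : HasDerivAt (fun s : ℝ => Real.exp (-l * s)) (Real.exp (-l * s) * (-l)) s := by
        simpa using ((hasDerivAt_id s).const_mul (-l)).exp
      have h6 : HasDerivAt (fun s => Real.exp (-l * s) • T s z) _ s := h5.smul h3
      refine h6.congr_deriv ?_
      rw [map_sub, map_smul, ← RCLike.real_smul_eq_coe_smul]
      module)
    (by
      refine (IntervalIntegrable.neg ?_)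
      refine ((hcont.continuousOn.smul ((h0.continuousOn_apply hd y).mono ?_)).intervalIntegrable)
      rw [uIcc_of_le zero_le_one]
      exact Icc_subset_Ici_self)
  rw [intervalIntegral.integral_neg] at h
  rw [neg_eq_iff_eq_neg] at h
  rw [h]
  simp [h0.zero]

include h0 hd hB hw in
theorem exists_norm_smul_opResolventClosure_le : ∃ C : ℝ, 0 < C ∧ ∀ᶠ l : ℝ in atTop,
    ∀ y : domClosure A, ‖(l : 𝕜) • opResolventClosure A (l : 𝕜) y‖ ≤ C * ‖y‖ := by
  obtain ⟨M, hM0, hM⟩ := h0.exists_norm_le hd 1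
  -- `M` bounds `T` on `[0, 1]`. The factor `2` comes from absorbing `e^{-l} T(1) z`, whose norm is
  -- at most `‖z‖ / 2` once `e^{-l} < 1 / (2M)`.
  refine ⟨2 * M, by positivity, ?_⟩
  have h1 : ∀ᶠ l : ℝ in atTop, Real.exp (-l) < 1 / (2 * M) :=
    (Real.tendsto_exp_neg_atTop_nhds_zero).eventually (eventually_lt_nhds (by positivity))
  filter_upwards [h1, eventually_gt_atTop w, eventually_gt_atTop 0] with l hl hlw hl0 y
  have h2 := opResolventClosure_sub_exp_smul h0 hd hB (hw l hlw) y
  set z := opResolventClosure A (l : 𝕜) (y : H) with hz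
  have h3 : ‖∫ s in (0 : ℝ)..1, Real.exp (-l * s) • T s y‖ ≤ M * ‖y‖ / l := by
    have h4 : ‖∫ s in (0 : ℝ)..1, Real.exp (-l * s) • T s y‖ ≤
        ∫ s in (0 : ℝ)..1, Real.exp (-l * s) * (M * ‖y‖) := by
      refine intervalIntegral.norm_integral_le_of_norm_le zero_le_one ?_
        (Continuous.intervalIntegrable (by fun_prop) _ _)
      refine Eventually.of_forall fun s hs => ?_
      rw [norm_smul, Real.norm_of_nonneg (Real.exp_pos _).le]
      gcongr
      exact (T s).le_of_opNorm_le (hM s ⟨hs.1.le, hs.2⟩) y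
    refine h4.trans ?_
    rw [intervalIntegral.integral_mul_const,
      intervalIntegral.integral_comp_mul_left (fun s => Real.exp s) (neg_ne_zero.2 hl0.ne')]
    simp only [mul_zero, mul_one, integral_exp, Real.exp_zero, smul_eq_mul]
    rw [div_eq_inv_mul]
    have h5 : (-l)⁻¹ * (Real.exp (-l) - 1) ≤ l⁻¹ := by
      rw [inv_neg]
      have := mul_nonneg (inv_pos.2 hl0).le (Real.exp_pos (-l)).le
      nlinarith
    gcongr
  have h6 : ‖Real.exp (-l) • T 1 z‖ ≤ 1 / 2 * ‖z‖ := by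
    rw [norm_smul, Real.norm_of_nonneg (Real.exp_pos _).le]
    have h7 : ‖T 1 z‖ ≤ M * ‖z‖ := (T 1).le_of_opNorm_le (hM 1 ⟨zero_le_one, le_rfl⟩) z
    calc Real.exp (-l) * ‖T 1 z‖ ≤ 1 / (2 * M) * (M * ‖z‖) := by gcongr
      _ = 1 / 2 * ‖z‖ := by field_simp
  have h8 : ‖z‖ ≤ ‖z - Real.exp (-l) • T 1 z‖ + ‖Real.exp (-l) • T 1 z‖ := by
    simpa using norm_add_le (z - Real.exp (-l) • T 1 z) (Real.exp (-l) • T 1 z)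
  rw [h2] at h8
  have h9 : ‖z‖ ≤ 2 * (M * ‖y‖ / l) := by linarith
  rw [norm_smul, RCLike.norm_ofReal, abs_of_pos hl0]
  calc l * ‖z‖ ≤ l * (2 * (M * ‖y‖ / l)) := by gcongr
    _ = 2 * M * ‖y‖ := by field_simp

/-- `l R(l, A) y → y` as `l → ∞` for `y` in the closure of the domain. -/
theorem AlmostSectorialAssumption.tendsto_smul_opResolventClosure
    (hA : AlmostSectorialAssumption A T w p) (y : domClosure A) :
    Tendsto (fun l : ℝ => (l : 𝕜) • opResolventClosure A (l : 𝕜) y) atTop (𝓝 y) := by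
  obtain ⟨C, hC0, hC⟩ := exists_norm_smul_opResolventClosure_le hA.semigroup
    (fun t ht => hA.analytic.differentiableAt ht) hA.generator hA.resolvent
  rw [Metric.tendsto_nhds]
  intro ε hε
  have hy : (y : H) ∈ closure (A.domain : Set H) := by
    rw [← Submodule.topologicalClosure_coe]; exact y.2
  -- Density argument: on `D(A)` the error is `l R(l, A) z - z = R(l, A) A z`, which tends to `0`
  -- with `‖R(l, A)‖`. The replacement of `y` by `z` costs at most `(C + 1) ‖y - z‖`.
  obtain ⟨z', hz', hyz'⟩ := Metric.mem_closure_iff.1 hy (ε / (3 * (C + 1))) (by positivity)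
  set z : domClosure A := ⟨z', A.domain.le_topologicalClosure hz'⟩ with hz
  have hyz : ‖y - z‖ < ε / (3 * (C + 1)) := by rwa [dist_eq_norm] at hyz'
  have h1 : Tendsto (fun l : ℝ => ‖opResolvent A (l : 𝕜)‖ * ‖A ⟨z', hz'⟩‖) atTop (𝓝 0) := by
    simpa using hA.tendsto_norm_opResolvent.mul_const ‖A ⟨z', hz'⟩‖
  filter_upwards [hC, h1.eventually (eventually_lt_nhds (show 0 < ε / 3 by positivity)),
    eventually_gt_atTop w] with l hl hl1 hlw
  have h2 : ‖(l : 𝕜) • opResolventClosure A (l : 𝕜) z - z‖ < ε / 3 := by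
    have h3 : (((l : 𝕜) • opResolventClosure A (l : 𝕜) z - z : domClosure A) : H) =
        opResolvent A (l : 𝕜) (A ⟨z', hz'⟩) := by
      have h4 := (isResolventAt_opResolvent (hA.resolvent l hlw)).2 ⟨z', hz'⟩
      rw [map_sub, map_smul] at h4
      rw [Submodule.coe_sub, Submodule.coe_smul, coe_opResolventClosure]
      change (l : 𝕜) • opResolvent A (l : 𝕜) z' - z' = _
      rw [sub_eq_iff_eq_add] at h4 ⊢
      rw [add_comm]
      exact h4
    rw [Submodule.coe_norm, h3]
    exact ((opResolvent A (l : 𝕜)).le_opNorm _).trans_lt hl1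
  have h5 := hl (y - z)
  rw [dist_eq_norm]
  have h6 : (l : 𝕜) • opResolventClosure A (l : 𝕜) y - y =
      (l : 𝕜) • opResolventClosure A (l : 𝕜) ((y - z : domClosure A) : H) +
      ((l : 𝕜) • opResolventClosure A (l : 𝕜) z - z) - (y - z) := by
    rw [Submodule.coe_sub, map_sub, smul_sub]
    abel
  have h7 : (C + 1) * ‖y - z‖ < ε / 3 := by
    calc (C + 1) * ‖y - z‖ < (C + 1) * (ε / (3 * (C + 1))) := by gcongr
      _ = ε / 3 := by field_simp
  rw [h6]
  refine (norm_sub_le _ _).trans_lt ((add_le_add_left (norm_add_le _ _) _).trans_lt ?_)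
  linarith

end ResolventLimit

/-! ### Convolution of an integrable operator kernel with a bounded continuous function. -/

section VolterraConvolution

variable {𝕜 : Type*} [RCLike 𝕜] {X Y : Type*}
  [NormedAddCommGroup X] [NormedSpace 𝕜 X] [NormedSpace ℝ X] [IsScalarTower ℝ 𝕜 X]
  [NormedAddCommGroup Y] [NormedSpace 𝕜 Y] [NormedSpace ℝ Y] [IsScalarTower ℝ 𝕜 Y]
  {W : ℝ → X →L[𝕜] Y}

theorem MeasureTheory.AEStronglyMeasurable.clm_apply_of_real {α : Type*} [MeasurableSpace α]
    {μ : Measure α} {c : α → X →L[𝕜] Y} {u : α → X} (hc : AEStronglyMeasurable c μ)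
    (hu : AEStronglyMeasurable u μ) : AEStronglyMeasurable (fun a => c a (u a)) μ :=
  (isBoundedBilinearMap_apply (𝕜 := 𝕜) (E := X) (F := Y)).continuous.comp_aestronglyMeasurable
    (hc.prodMk hu)

theorem IntervalIntegrable.clm_apply_continuousOn {a b : ℝ} (hW : IntervalIntegrable W volume a b)
    {u : ℝ → X} (hu : ContinuousOn u (uIcc a b)) :
    IntervalIntegrable (fun s => W s (u s)) volume a b := by
  obtain ⟨C, hC⟩ := isCompact_uIcc.exists_bound_of_continuousOn hu
  rw [intervalIntegrable_iff] at hW ⊢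
  refine Integrable.mono' (hW.norm.mul_const C) (hW.1.clm_apply_of_real
    ((hu.mono uIoc_subset_uIcc).aestronglyMeasurable measurableSet_uIoc)) ?_
  filter_upwards [ae_restrict_mem measurableSet_uIoc] with s hs
  exact ((W s).le_opNorm _).trans (by gcongr; exact hC s (uIoc_subset_uIcc hs))

/-- Extending `g` by zero to negative arguments replaces the moving endpoint by a fixed one, so that
dominated convergence and Fubini apply on one interval. -/
theorem integral_clm_apply_indicator {t τ : ℝ} (ht : t ∈ Icc 0 τ) (g : ℝ → X) :
    ∫ s in (0 : ℝ)..τ, W s ((Ici 0).indicator g (t - s)) =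
      ∫ s in (0 : ℝ)..t, W s (g (t - s)) := by
  rw [intervalIntegral.integral_of_le (ht.1.trans ht.2), intervalIntegral.integral_of_le ht.1,
    ← integral_indicator measurableSet_Ioc, ← integral_indicator measurableSet_Ioc]
  congr 1
  ext s
  simp only [indicator, mem_Ioc, mem_Ici, sub_nonneg]
  have := ht.2
  split_ifs <;> first | rfl | (exfalso; grind) | simp

variable [CompleteSpace Y] {τ : ℝ} (hW : IntervalIntegrable W volume 0 τ) {g : ℝ → X}
  (hg : Continuous g)

include hW hg in
theorem continuousOn_convolution {C : ℝ} (hC : ∀ s, ‖g s‖ ≤ C) :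
    ContinuousOn (fun t => ∫ s in (0 : ℝ)..t, W s (g (t - s))) (Icc 0 τ) := by
  have h0 : ∀ s, ‖(Ici (0 : ℝ)).indicator g s‖ ≤ C := fun s =>
    (norm_indicator_le_norm_self _ _).trans (hC s)
  have hmeas : StronglyMeasurable ((Ici (0 : ℝ)).indicator g) :=
    hg.stronglyMeasurable.indicator measurableSet_Ici
  have h1 : Continuous fun t => ∫ s in (0 : ℝ)..τ, W s ((Ici 0).indicator g (t - s)) := by
    rw [continuous_iff_continuousAt]
    intro t
    refine intervalIntegral.continuousAt_of_dominated_interval (bound := fun s => ‖W s‖ * C)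
      (Eventually.of_forall fun x => ?_) (Eventually.of_forall fun x => ?_)
      (hW.norm.mul_const C) ?_
    · rw [intervalIntegrable_iff] at hW
      exact hW.1.clm_apply_of_real
        (hmeas.comp_measurable (measurable_const.sub measurable_id)).aestronglyMeasurable
    · refine Eventually.of_forall fun s _ => ((W s).le_opNorm _).trans ?_
      gcongr
      exact h0 _
    -- The zero extension of `g` can jump only at argument `0`, that is at `s = t`, a null set.
    · have h2 : ∀ᵐ s : ℝ, s ≠ t := by simp [ae_iff]
      filter_upwards [h2] with s hs _
      refine (W s).continuous.continuousAt.comp ?_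
      refine ContinuousAt.comp (g := (Ici (0 : ℝ)).indicator g) ?_ (by fun_prop)
      rcases lt_or_gt_of_ne hs with h | h
      · refine hg.continuousAt.congr ?_
        filter_upwards [eventually_gt_nhds (sub_pos.2 h)] with a ha
        rw [indicator_of_mem (mem_Ici.2 ha.le)]
      · refine (continuousAt_const (y := (0 : X))).congr ?_
        filter_upwards [eventually_lt_nhds (sub_neg.2 h)] with a ha
        rw [indicator_of_notMem (by simpa using ha)]
  refine h1.continuousOn.congr fun t ht => (integral_clm_apply_indicator ht g).symm

variable [CompleteSpace X]

theorem integral_indicator_sub {s : ℝ} (hs : s ∈ Ioc 0 τ) :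
    ∫ r in (0 : ℝ)..τ, (Ici 0).indicator g (r - s) = ∫ a in (0 : ℝ)..(τ - s), g a := by
  have h1 : ∀ r, (Ici 0).indicator g (r - s) = (Ici s).indicator (fun r => g (r - s)) r := by
    intro r
    simp [indicator]
  have h2 : Ioc 0 τ ∩ Ici s = Icc s τ := by
    ext r
    simp only [mem_inter_iff, mem_Ioc, mem_Ici, mem_Icc]
    have := hs.1
    constructor <;> intro h <;> grind
  simp_rw [h1]
  rw [intervalIntegral.integral_of_le (hs.1.le.trans hs.2), setIntegral_indicator measurableSet_Ici,
    h2, integral_Icc_eq_integral_Ioc, ← intervalIntegral.integral_of_le hs.2,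
    intervalIntegral.integral_comp_sub_right g s, sub_self]

include hW hg in
/-- Integrating a convolution amounts to integrating one of the factors. -/
theorem integral_convolution {C : ℝ} (hC : ∀ s, ‖g s‖ ≤ C) (hτ : 0 ≤ τ) :
    ∫ r in (0 : ℝ)..τ, ∫ s in (0 : ℝ)..r, W s (g (r - s)) =
      ∫ s in (0 : ℝ)..τ, W s (∫ a in (0 : ℝ)..(τ - s), g a) := by
  have h0 : ∀ s, ‖(Ici (0 : ℝ)).indicator g s‖ ≤ C := fun s =>
    (norm_indicator_le_norm_self _ _).trans (hC s)
  have hmeas : StronglyMeasurable ((Ici (0 : ℝ)).indicator g) :=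
    hg.stronglyMeasurable.indicator measurableSet_Ici
  have h1 : ∫ r in (0 : ℝ)..τ, ∫ s in (0 : ℝ)..r, W s (g (r - s)) =
      ∫ r in (0 : ℝ)..τ, ∫ s in (0 : ℝ)..τ, W s ((Ici 0).indicator g (r - s)) := by
    refine intervalIntegral.integral_congr fun r hr => ?_
    rw [uIcc_of_le hτ] at hr
    exact (integral_clm_apply_indicator hr g).symm
  have hW' := intervalIntegrable_iff.1 hW
  rw [h1, intervalIntegral_intervalIntegral_swap]
  · refine intervalIntegral.integral_congr_ae (Eventually.of_forall fun s hs => ?_)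
    rw [uIoc_of_le hτ] at hs
    rw [(W s).intervalIntegral_comp_comm_of_real, integral_indicator_sub hs]
    rw [intervalIntegrable_iff]
    refine IntegrableOn.of_bound (by simp) ?_ C (Eventually.of_forall fun r => h0 _)
    exact (hmeas.comp_measurable (measurable_id.sub measurable_const)).aestronglyMeasurable
  · rw [uIoc_of_le hτ] at hW' ⊢
    rw [IntegrableOn, Measure.volume_eq_prod, ← Measure.prod_restrict]
    have h2 : Integrable (fun q : ℝ × ℝ => ‖W q.2‖ * C)
        ((volume.restrict (Ioc 0 τ)).prod (volume.restrict (Ioc 0 τ))) :=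
      (hW'.norm.mul_const C).comp_snd _
    refine Integrable.mono' h2 ?_ (Eventually.of_forall fun q => ?_)
    · exact hW'.1.comp_snd.clm_apply_of_real
        (hmeas.comp_measurable (measurable_fst.sub measurable_snd)).aestronglyMeasurable
    · refine ((W q.2).le_opNorm _).trans ?_
      gcongr
      exact h0 _

end VolterraConvolution

/-! ### The deterministic integrated equation in resolvent form, and uniqueness. -/

noncomputable section DeterministicProblem

variable {𝕜 : Type*} [RCLike 𝕜] {H : Type*} [NormedAddCommGroup H] [InnerProductSpace 𝕜 H]
  [NormedSpace ℝ H] [IsScalarTower ℝ 𝕜 H] [CompleteSpace H]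
  {A : H →ₗ.[𝕜] H} {T : ℝ → domClosure A →L[𝕜] domClosure A} {w : ℝ}
  (h0 : IsC0Semigroup T) (hd : ∀ t : ℝ, 0 < t → DifferentiableAt ℝ T t)
  (hB : IsSemigroupGenerator T (partInClosure A))
  (hw : ∀ l : ℝ, w < l → (l : 𝕜) ∈ opResolventSet A)

/-- The convolution `∫₀ᵗ (l I - A₀) T(t - s) R(l, A) f(s) ds` with values in `H₀`. -/
def orbitConvolution (A : H →ₗ.[𝕜] H) (T : ℝ → domClosure A →L[𝕜] domClosure A) (l : 𝕜)
    (f : ℝ → H) (t : ℝ) : domClosure A :=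
  ∫ s in (0 : ℝ)..t, resolventOrbit A T l (t - s) (f s)

include hB hw h0 hd in
/-- The resolvent form of the integrated equation with zero initial value. -/
theorem convolution_resolvent_identity {l m : ℝ} (hl : w < l) (hm : w < m) {τ : ℝ} (hτ : 0 ≤ τ)
    (hW : IntervalIntegrable (resolventOrbit A T (l : 𝕜)) volume 0 τ) {g : ℝ → H}
    (hg : Continuous g) {C : ℝ} (hC : ∀ s, ‖g s‖ ≤ C) :
    ∫ r in (0 : ℝ)..τ, ∫ s in (0 : ℝ)..r, resolventOrbit A T (l : 𝕜) s (g (r - s)) =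
      opResolventClosure A (m : 𝕜)
        ((m : 𝕜) • ((∫ r in (0 : ℝ)..τ, ∫ s in (0 : ℝ)..r,
            resolventOrbit A T (l : 𝕜) s (g (r - s)) : domClosure A) : H)
          + (∫ s in (0 : ℝ)..τ, g s)
          - ((∫ s in (0 : ℝ)..τ, resolventOrbit A T (l : 𝕜) s (g (τ - s)) : domClosure A) : H)) := by
  set W := resolventOrbit A T (l : 𝕜) with hWdef
  rw [integral_convolution hW hg hC hτ]
  set F : ℝ → H := fun a => ∫ b in (0 : ℝ)..a, g b with hF
  have hFd : ∀ a, HasDerivAt F (g a) a := fun a =>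
    intervalIntegral.integral_hasDerivAt_right (hg.intervalIntegrable _ _)
      (hg.stronglyMeasurableAtFilter _ _) hg.continuousAt
  have hFc : Continuous F := continuous_iff_continuousAt.2 fun a => (hFd a).continuousAt
  set R := opResolventClosure A (m : 𝕜) with hR
  set R' : domClosure A →L[𝕜] domClosure A := R.comp (domClosure A).subtypeL with hR'
  have hRW : ∀ s, 0 < s → ∀ x, T s (R x) = R' (W s x) := by
    intro s hs x
    rw [hWdef, resolventOrbit_congr h0 hd hB hw hl hm hs]
    exact (opResolventClosure_resolventOrbit h0 hd hB (hw m hm) hs x).symm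
  have hT' : ∀ s, 0 < s → ∀ x, deriv T s (R x) = (m : 𝕜) • R' (W s x) - W s x := by
    intro s hs x
    rw [← hRW s hs, hWdef, resolventOrbit_congr h0 hd hB hw hl hm hs, resolventOrbit_apply,
      sub_sub_cancel]
  have hI1 : IntervalIntegrable (fun s => W s (F (τ - s))) volume 0 τ :=
    hW.clm_apply_continuousOn (hFc.comp (continuous_const.sub continuous_id)).continuousOn
  have hI2 : IntervalIntegrable (fun s => W s (g (τ - s))) volume 0 τ :=
    hW.clm_apply_continuousOn (hg.comp (continuous_const.sub continuous_id)).continuousOn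
  have hI1' := hI1.clm_comp_of_real R'
  have hI2' := hI2.clm_comp_of_real R'
  have hI1m : IntervalIntegrable (fun s => (m : 𝕜) • R' (W s (F (τ - s)))) volume 0 τ :=
    hI1.clm_comp_of_real ((m : 𝕜) • R')
  -- In the derivative of `T(s) R F(τ - s)`, the term `T'(s) R` equals `m R' W(s) - W(s)` and `T(s)
  -- R` equals `R' W(s)`. Hence only the integrable kernel `W` occurs, although `T'` may be singular
  -- at `0`.
  have hftc := intervalIntegral.integral_eq_sub_of_hasDerivAt_of_le
    (f := fun s => T s (R (F (τ - s))))
    (f' := fun s => (m : 𝕜) • R' (W s (F (τ - s))) - W s (F (τ - s)) - R' (W s (g (τ - s))))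
    hτ ?_ ?_ ((hI1m.sub hI1).sub hI2')
  · have h1 : ∫ s in (0 : ℝ)..τ, (m : 𝕜) • R' (W s (F (τ - s))) =
        (m : 𝕜) • R' (∫ s in (0 : ℝ)..τ, W s (F (τ - s))) :=
      ((m : 𝕜) • R').intervalIntegral_comp_comm_of_real hI1
    rw [intervalIntegral.integral_sub (hI1m.sub hI1) hI2', intervalIntegral.integral_sub hI1m hI1,
      h1, R'.intervalIntegral_comp_comm_of_real hI2] at hftc
    have hF0 : F 0 = 0 := by simp [hF]
    simp only [sub_self, hF0, map_zero, h0.zero, sub_zero, zero_sub,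
      ContinuousLinearMap.id_apply] at hftc
    rw [map_sub, map_add, map_smul]
    change _ = (m : 𝕜) • R' (∫ s in (0 : ℝ)..τ, W s (F (τ - s))) + R (F τ) -
      R' (∫ s in (0 : ℝ)..τ, W s (g (τ - s)))
    rw [← neg_eq_iff_eq_neg.2 hftc]
    abel
  · intro s hs
    have h2 : Tendsto (fun s => R (F (τ - s))) (𝓝[Icc 0 τ] s) (𝓝 (R (F (τ - s)))) :=
      ((R.continuous.comp (hFc.comp (continuous_const.sub continuous_id))).tendsto s).mono_left
        nhdsWithin_le_nhds
    exact h0.tendsto_apply hd (tendsto_id.mono_right (nhdsWithin_mono _ Icc_subset_Ici_self)) hs.1 h2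
  · intro s hs
    have h3 : HasDerivAt (fun s => R (F (τ - s))) (-(R (g (τ - s)))) s := by
      have h4 : HasDerivAt (fun s => F (τ - s)) (-(g (τ - s))) s :=
        (hFd (τ - s)).comp_const_sub τ s
      rw [← map_neg]
      exact (R.restrictScalars ℝ).hasFDerivAt.comp_hasDerivAt s h4
    have h5 := (hd s hs.1).hasDerivAt.clm_apply_of_real h3
    refine h5.congr_deriv ?_
    rw [hT' s hs.1, map_neg, hRW s hs.1]
    abel

include hB hw h0 hd in
/-- The resolvent form of the integrated equation for an orbit of the semigroup. -/
theorem orbit_resolvent_identity {m : ℝ} (hm : w < m) {t : ℝ} (ht : 0 ≤ t) (ξ : domClosure A) :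
    ∫ s in (0 : ℝ)..t, T s ξ = opResolventClosure A (m : 𝕜)
      ((((m : 𝕜) • (∫ s in (0 : ℝ)..t, T s ξ) - (T t ξ - ξ) : domClosure A)) : H) :=
  (exists_partInClosure_apply_eq_iff (hw m hm)).1
    (partInClosure_integral h0 hd hB (hw m hm) ht ξ)

include hB hw h0 hd in
/-- The homogeneous integrated equation has only the zero solution. -/
theorem eq_zero_of_integrated_homogeneous {m : ℝ} (hm : w < m) {τ : ℝ} {v : ℝ → H}
    (hv : ContinuousOn v (Icc 0 τ))
    (hZ : ∀ t ∈ Icc 0 τ, ∃ h : (∫ s in (0 : ℝ)..t, v s) ∈ A.domain,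
      A ⟨∫ s in (0 : ℝ)..t, v s, h⟩ = v t) : ∀ t ∈ Icc 0 τ, v t = 0 := by
  intro t ht
  have hvt : ContinuousOn v (Icc 0 t) := hv.mono (Icc_subset_Icc_right ht.2)
  set R := opResolventClosure A (m : 𝕜) with hR
  -- Applying the resolvent to the primitive of `v` gives a classical solution of `Q' = A₀ Q` with
  -- `Q 0 = 0`, to which the usual uniqueness argument applies.
  set Q : ℝ → domClosure A := fun s => R (∫ a in (0 : ℝ)..s, v a) with hQ
  have hQd : ∀ s ∈ Ioo 0 t, HasDerivAt Q (R (v s)) s := by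
    intro s hs
    have h1 : HasDerivAt (fun s => ∫ a in (0 : ℝ)..s, v a) (v s) s := by
      have hsn : Icc 0 t ∈ 𝓝 s := Icc_mem_nhds hs.1 hs.2
      refine intervalIntegral.integral_hasDerivAt_right ?_ ?_ (hvt.continuousAt hsn)
      · refine (hvt.mono ?_).intervalIntegrable
        rw [uIcc_of_le hs.1.le]
        exact Icc_subset_Icc_right hs.2.le
      · exact (hvt.mono Ioo_subset_Icc_self).stronglyMeasurableAtFilter isOpen_Ioo s hs
    exact (R.restrictScalars ℝ).hasFDerivAt.comp_hasDerivAt s h1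
  have hQc : ContinuousOn Q (Icc 0 t) := by
    have h1 : ContinuousOn (fun s => ∫ a in (0 : ℝ)..s, v a) (Icc 0 t) := by
      have := intervalIntegral.continuousOn_primitive_interval
        (μ := volume) (f := v) (a := 0) (b := t)
        (by rw [uIcc_of_le ht.1]; exact hvt.integrableOn_Icc)
      rwa [uIcc_of_le ht.1] at this
    exact R.continuous.comp_continuousOn h1
  have hQdom : ∀ s ∈ Icc 0 t, ∃ h : Q s ∈ (partInClosure A).domain,
      partInClosure A ⟨Q s, h⟩ = R (v s) := by
    intro s hs
    rw [exists_partInClosure_apply_eq_iff (hw m hm)]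
    obtain ⟨h1, h2⟩ := hZ s ⟨hs.1, hs.2.trans ht.2⟩
    have h3 := (exists_apply_eq_iff (hw m hm)).1 ⟨h1, h2⟩
    have h4 : (((m : 𝕜) • Q s - R (v s) : domClosure A) : H) = ∫ a in (0 : ℝ)..s, v a := by
      rw [h3, map_sub, map_smul]; rfl
    rw [h4]
  -- The two contributions to the derivative of `T(t - s) Q(s)` cancel, so its values `0` at `s = 0`
  -- and `Q t` at `s = t` agree.
  have hftc := intervalIntegral.integral_eq_sub_of_hasDerivAt_of_le
    (f := fun s => T (t - s) (Q s)) (f' := fun _ => 0) ht.1 ?_ ?_ (by simp)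
  · have h1 : Q t = 0 := by simpa [hQ, h0.zero, eq_comm] using hftc
    obtain ⟨h2, h3⟩ := hQdom t ⟨ht.1, le_rfl⟩
    obtain ⟨h4, h5⟩ := hZ t ht
    have h6 : ∫ a in (0 : ℝ)..t, v a = 0 :=
      opResolvent_injective (hw m hm) ((congrArg Subtype.val h1).trans (map_zero _).symm)
    rw [← h5]
    simp only [h6]
    exact A.map_zero
  · intro s hs
    refine h0.tendsto_apply hd ?_ (sub_nonneg.2 hs.2) (hQc s hs)
    refine tendsto_nhdsWithin_iff.2 ⟨?_, ?_⟩
    · exact ((continuous_const.sub continuous_id).tendsto s).mono_left nhdsWithin_le_nhds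
    · filter_upwards [self_mem_nhdsWithin] with a ha using sub_nonneg.2 ha.2
  · intro s hs
    have hts : 0 < t - s := sub_pos.2 hs.2
    have h1 : HasDerivAt (fun s => T (t - s)) (-deriv T (t - s)) s :=
      (hd (t - s) hts).hasDerivAt.comp_const_sub t s
    refine (h1.clm_apply_of_real (hQd s hs)).congr_deriv ?_
    obtain ⟨h2, h3⟩ := hQdom s ⟨hs.1.le, hs.2.le⟩
    have h4 := hB.deriv_apply h0 hd hts ⟨Q s, h2⟩
    rw [h3] at h4
    simp [h4]

end DeterministicProblem

/-! ### The Hilbert-Schmidt norm. -/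

section HilbertSchmidt

variable {𝕜 : Type*} [RCLike 𝕜] {H : Type*} [NormedAddCommGroup H] [InnerProductSpace 𝕜 H]

/-- Distinct orthonormal vectors are at distance `√2 > 1`, so the balls of radius `1/2` around them
are disjoint. -/
theorem Orthonormal.countable_of_separableSpace [TopologicalSpace.SeparableSpace H] {ι : Type*}
    {v : ι → H} (hv : Orthonormal 𝕜 v) : Countable ι := by
  refine Pairwise.countable_of_isOpen_disjoint (s := fun i => Metric.ball (v i) (1 / 2)) ?_
    (fun i => Metric.isOpen_ball) (fun i => ⟨v i, Metric.mem_ball_self (by norm_num)⟩)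
  intro i j hij
  refine Metric.ball_disjoint_ball ?_
  have h1 : ‖v i - v j‖ ^ 2 = 2 := by
    rw [@norm_sub_sq 𝕜, hv.1 i, hv.1 j, hv.2 hij]
    norm_num
  rw [dist_eq_norm]
  nlinarith [norm_nonneg (v i - v j)]

theorem HilbertBasis.hasSum_norm_inner_sq {ι : Type*} (b : HilbertBasis ι 𝕜 H) (x : H) :
    HasSum (fun i => ‖inner 𝕜 (b i) x‖ ^ 2) (‖x‖ ^ 2) := by
  have h := RCLike.hasSum_re 𝕜 (b.hasSum_inner_mul_inner x x)
  rw [inner_self_eq_norm_sq] at h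
  have h1 : ∀ i, RCLike.re (inner 𝕜 x (b i) * inner 𝕜 (b i) x) = ‖inner 𝕜 (b i) x‖ ^ 2 :=
    fun i => by rw [← inner_conj_symm x, RCLike.conj_mul, ← RCLike.ofReal_pow, RCLike.ofReal_re]
  simpa only [h1] using h

theorem HilbertBasis.tsum_enorm_inner_sq {ι : Type*} (b : HilbertBasis ι 𝕜 H) (x : H) :
    ∑' i, ‖inner 𝕜 (b i) x‖ₑ ^ 2 = ‖x‖ₑ ^ 2 := by
  have h := b.hasSum_norm_inner_sq x
  have h1 : ∀ {F : Type _} [NormedAddCommGroup F] (y : F), ‖y‖ₑ ^ 2 = ENNReal.ofReal (‖y‖ ^ 2) :=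
    fun y => by rw [ENNReal.ofReal_pow (norm_nonneg _), ofReal_norm]
  rw [h1 x, ← h.tsum_eq, ENNReal.ofReal_tsum_of_nonneg (fun i => by positivity) h.summable]
  refine tsum_congr fun i => ?_
  rw [ENNReal.ofReal_pow (norm_nonneg _), ofReal_norm]

variable [CompleteSpace H]

variable (𝕜 H) in
theorem exists_hilbertBasis_hsNormSq : ∃ b : HilbertBasis (exists_hilbertBasis 𝕜 H).choose 𝕜 H,
    ∀ B : H →L[𝕜] H, hsNormSq B = ∑' e, ‖B (b e)‖ₑ ^ 2 := by
  obtain ⟨b, hb⟩ := (exists_hilbertBasis 𝕜 H).choose_spec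
  exact ⟨b, fun B => by rw [hsNormSq, hb]⟩

/-- Both sides are the sum of all squared matrix entries, summed by rows or by columns. -/
theorem HilbertBasis.tsum_enorm_adjoint_sq {ι : Type*} (b : HilbertBasis ι 𝕜 H) (B : H →L[𝕜] H) :
    ∑' i, ‖ContinuousLinearMap.adjoint B (b i)‖ₑ ^ 2 = ∑' i, ‖B (b i)‖ₑ ^ 2 := by
  simp_rw [← b.tsum_enorm_inner_sq]
  rw [ENNReal.tsum_comm]
  refine tsum_congr fun i => tsum_congr fun j => ?_
  rw [ContinuousLinearMap.adjoint_inner_right, ← inner_conj_symm, RCLike.enorm_conj]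

/-- The bound is proved for the adjoint: `‖B* x‖² = ∑ᵢ |⟨B eᵢ, x⟩|²`, to which Cauchy-Schwarz
applies term by term. -/
theorem enorm_sq_le_hsNormSq (B : H →L[𝕜] H) : ‖B‖ₑ ^ 2 ≤ hsNormSq B := by
  obtain ⟨b, hb⟩ := exists_hilbertBasis_hsNormSq 𝕜 H
  by_cases htop : hsNormSq B = ⊤
  · simp [htop]
  have h1 : ∀ x, ‖ContinuousLinearMap.adjoint B x‖ₑ ^ 2 ≤ hsNormSq B * ‖x‖ₑ ^ 2 := by
    intro x
    rw [← b.tsum_enorm_inner_sq, hb, ← ENNReal.tsum_mul_right]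
    refine ENNReal.tsum_le_tsum fun i => ?_
    rw [ContinuousLinearMap.adjoint_inner_right, ← mul_pow]
    gcongr
    simpa [enorm_eq_nnnorm] using (by exact_mod_cast nnnorm_inner_le_nnnorm (𝕜 := 𝕜) (B (b i)) x :
      (‖inner 𝕜 (B (b i)) x‖₊ : ℝ≥0∞) ≤ ‖B (b i)‖₊ * ‖x‖₊)
  have h2 : ‖ContinuousLinearMap.adjoint B‖ ≤ Real.sqrt (hsNormSq B).toReal := by
    refine ContinuousLinearMap.opNorm_le_bound _ (Real.sqrt_nonneg _) fun x => ?_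
    rw [← Real.sqrt_sq (norm_nonneg x), ← Real.sqrt_mul ENNReal.toReal_nonneg]
    refine Real.le_sqrt_of_sq_le ?_
    have h3 := ENNReal.toReal_mono (by finiteness) (h1 x)
    simpa using h3
  rw [LinearIsometryEquiv.norm_map] at h2
  rw [← ofReal_norm, ← ENNReal.ofReal_pow (norm_nonneg _)]
  refine ENNReal.ofReal_le_of_le_toReal ?_
  have := Real.sq_sqrt (ENNReal.toReal_nonneg (a := hsNormSq B))
  rw [← this]
  gcongr

end HilbertSchmidt

/-! ### Parseval's identity for operator kernels. -/

section Parseval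

theorem MeasureTheory.eLpNorm_two_sq {α F : Type*} [MeasurableSpace α] {μ : Measure α}
    [NormedAddCommGroup F] (f : α → F) : eLpNorm f 2 μ ^ 2 = ∫⁻ a, ‖f a‖ₑ ^ 2 ∂μ := by
  have h := eLpNorm_nnreal_pow_eq_lintegral (μ := μ) (f := f) (p := 2) (by norm_num)
  have h2 : ((2 : NNReal) : ℝ) = ((2 : ℕ) : ℝ) := by norm_num
  simp only [h2, ENNReal.rpow_natCast] at h
  exact_mod_cast h

variable {𝕜 : Type*} [RCLike 𝕜] {H : Type*} [NormedAddCommGroup H] [InnerProductSpace 𝕜 H]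
  [CompleteSpace H] [NormedSpace ℝ H] [IsScalarTower ℝ 𝕜 H]
  {α : Type*} [MeasurableSpace α] {μ : Measure α} {K : α → H →L[𝕜] H}

theorem MeasureTheory.MemLp.integrable_clm_apply (hK : MemLp K 2 μ) {f : α → H}
    (hf : MemLp f 2 μ) : Integrable (fun a => K a (f a)) μ :=
  (hK.norm.integrable_mul hf.norm).mono' (hK.1.clm_apply_of_real hf.1)
    (Eventually.of_forall fun a => (K a).le_opNorm _)

theorem MeasureTheory.MemLp.adjoint_apply (hK : MemLp K 2 μ) (h : H) :
    MemLp (fun a => ContinuousLinearMap.adjoint (K a) h) 2 μ := by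
  refine hK.of_le_mul (c := ‖h‖) ?_ (Eventually.of_forall fun a => ?_)
  · exact ((ContinuousLinearMap.adjoint (𝕜 := 𝕜) (E := H)
      (F := H)).continuous.comp_aestronglyMeasurable hK.1).clm_apply_of_real aestronglyMeasurable_const
  · rw [mul_comm, ← LinearIsometryEquiv.norm_map ContinuousLinearMap.adjoint (K a)]
    exact ContinuousLinearMap.le_opNorm _ _

theorem inner_toLp_adjoint_apply (hK : MemLp K 2 μ) (h : H) (g : Lp H 2 μ) {φ : α → H}
    (hφ : g =ᵐ[μ] φ) :
    inner 𝕜 ((hK.adjoint_apply h).toLp _) g = inner 𝕜 h (∫ a, K a (φ a) ∂μ) := by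
  have hφ2 : MemLp φ 2 μ := (memLp_congr_ae hφ).1 (Lp.memLp g)
  rw [L2.inner_def, ← integral_inner (hK.integrable_clm_apply hφ2)]
  refine integral_congr_ae ?_
  filter_upwards [hφ, (hK.adjoint_apply h).coeFn_toLp] with a ha hb
  rw [hb, ha, ContinuousLinearMap.adjoint_inner_left]

/-- Parseval's identity for the Hilbert-Schmidt norm. -/
theorem tsum_enorm_integral_sq [TopologicalSpace.SeparableSpace H] (hK : MemLp K 2 μ)
    (b : HilbertBasis ℕ 𝕜 (Lp H 2 μ)) {φ : ℕ → α → H} (hφ : ∀ j, b j =ᵐ[μ] φ j) :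
    ∑' j, ‖∫ a, K a (φ j a) ∂μ‖ₑ ^ 2 = ∫⁻ a, hsNormSq (K a) ∂μ := by
  obtain ⟨e, he⟩ := exists_hilbertBasis_hsNormSq 𝕜 H
  have := e.orthonormal.countable_of_separableSpace
  -- Passing to adjoints yields the functions `a ↦ K(a)* eᵢ` in `L²`, whose coefficients in the
  -- basis `b` are, up to conjugation, the coordinates of the integrals `∫ K φⱼ`.
  rw [lintegral_congr fun a => (he (K a)).trans (e.tsum_enorm_adjoint_sq (K a)).symm]
  rw [lintegral_tsum fun i => ((hK.adjoint_apply (e i)).1.enorm.pow_const 2)]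
  rw [tsum_congr fun j => (e.tsum_enorm_inner_sq (∫ a, K a (φ j a) ∂μ)).symm, ENNReal.tsum_comm]
  refine tsum_congr fun i => ?_
  rw [← eLpNorm_two_sq, ← eLpNorm_congr_ae (hK.adjoint_apply (e i)).coeFn_toLp, ← Lp.enorm_def,
    ← b.tsum_enorm_inner_sq]
  refine tsum_congr fun j => ?_
  rw [← inner_toLp_adjoint_apply hK (e i) (b j) (hφ j), ← inner_conj_symm, RCLike.enorm_conj]

end Parseval

/-! ### Random series with orthonormal coefficients. -/

noncomputable section GaussianSeries

variable {𝕜 : Type*} [RCLike 𝕜] {K : Type*} [NormedAddCommGroup K] [InnerProductSpace 𝕜 K]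
  [NormedSpace ℝ K] [IsScalarTower ℝ 𝕜 K] {Ω : Type*} [MeasurableSpace Ω] {P : Measure Ω}

theorem MeasureTheory.MemLp.smul_const_of_real {f : Ω → ℝ} (hf : MemLp f 2 P) (x : K) :
    MemLp (fun o => f o • x) 2 P :=
  hf.of_le_mul (c := ‖x‖) (hf.1.smul_const x)
    (Eventually.of_forall fun o => by rw [norm_smul, mul_comm])

variable (𝕜 K) in
/-- The linear map `x ↦ f x` from `K` to `L²(Ω; K)`, for a real function `f ∈ L²(Ω)`. -/
def smulLp {f : Ω → ℝ} (hf : MemLp f 2 P) : K →ₗ[𝕜] Lp K 2 P where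
  toFun x := (hf.smul_const_of_real x).toLp _
  map_add' x y := by
    rw [← MemLp.toLp_add]
    exact MemLp.toLp_congr _ _ (Eventually.of_forall fun o => smul_add _ _ _)
  map_smul' c x := by
    rw [RingHom.id_apply, ← MemLp.toLp_const_smul]
    exact MemLp.toLp_congr _ _ (Eventually.of_forall fun o => smul_comm _ _ _)

theorem coeFn_smulLp {f : Ω → ℝ} (hf : MemLp f 2 P) (x : K) :
    smulLp 𝕜 K hf x =ᵐ[P] fun o => f o • x :=
  (hf.smul_const_of_real x).coeFn_toLp

theorem inner_smulLp {f g : Ω → ℝ} (hf : MemLp f 2 P) (hg : MemLp g 2 P) (x y : K) :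
    inner 𝕜 (smulLp 𝕜 K hf x) (smulLp 𝕜 K hg y) = ((∫ o, f o * g o ∂P : ℝ) : 𝕜) * inner 𝕜 x y := by
  rw [L2.inner_def, ← integral_ofReal, ← integral_mul_const]
  refine integral_congr_ae ?_
  filter_upwards [coeFn_smulLp (𝕜 := 𝕜) hf x, coeFn_smulLp (𝕜 := 𝕜) hg y] with o h1 h2
  rw [h1, h2, RCLike.real_smul_eq_coe_smul (K := 𝕜), RCLike.real_smul_eq_coe_smul (K := 𝕜),
    inner_smul_left, inner_smul_right, RCLike.conj_ofReal]
  push_cast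
  ring

variable (𝕜 K) in
/-- `smulLp` as an isometry, for a normalized function. -/
def smulLpIsometry {f : Ω → ℝ} (hf : MemLp f 2 P) (h1 : ∫ o, f o * f o ∂P = 1) :
    K →ₗᵢ[𝕜] Lp K 2 P :=
  LinearMap.isometryOfInner (smulLp 𝕜 K hf) fun x y => by simp [inner_smulLp, h1]

/-- An orthonormal sequence of real square integrable functions. -/
structure IsOrthonormalSeq (P : Measure Ω) (η : ℕ → Ω → ℝ) : Prop where
  memLp : ∀ j, MemLp (η j) 2 P
  integral_self : ∀ j, ∫ o, η j o * η j o ∂P = 1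
  integral_ne : ∀ i j, i ≠ j → ∫ o, η i o * η j o ∂P = 0

/-- Everything that follows uses only these second moments of the Gaussian variables. -/
theorem isOrthonormalSeq_of_gaussian [IsProbabilityMeasure P] {η : ℕ → Ω → ℝ}
    (hη : ∀ j, Measurable (η j)) (hlaw : ∀ j, HasLaw (η j) (gaussianReal 0 1) P)
    (hindep : iIndepFun η P) : IsOrthonormalSeq P η where
  memLp j := by
    have h := memLp_id_gaussianReal' (μ := 0) (v := 1) 2 (by simp)
    rw [← (hlaw j).map_eq] at h
    exact (memLp_map_measure_iff aestronglyMeasurable_id (hη j).aemeasurable).1 h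
  integral_self j := by
    have h := (hlaw j).integral_comp (f := fun x : ℝ => x * x)
      (by fun_prop : AEStronglyMeasurable (fun x : ℝ => x * x) (gaussianReal 0 1))
    have h2 := variance_fun_id_gaussianReal (μ := 0) (v := 1)
    rw [variance_eq_integral (by fun_prop), integral_id_gaussianReal] at h2
    simp only [sub_zero, pow_two, NNReal.coe_one] at h2
    rw [← h2, ← h]
    rfl
  integral_ne i j hij := by
    rw [(hindep.indepFun hij).integral_fun_mul_eq_mul_integral (hη i).aestronglyMeasurable
      (hη j).aestronglyMeasurable, (hlaw i).integral_eq, integral_id_gaussianReal, zero_mul]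

variable {η : ℕ → Ω → ℝ} (hη : IsOrthonormalSeq P η)

theorem IsOrthonormalSeq.orthogonalFamily :
    OrthogonalFamily 𝕜 (fun _ : ℕ => K)
      (fun j => smulLpIsometry 𝕜 K (hη.memLp j) (hη.integral_self j)) := by
  intro i j hij x y
  change inner 𝕜 (smulLp 𝕜 K (hη.memLp i) x) (smulLp 𝕜 K (hη.memLp j) y) = 0
  rw [inner_smulLp, hη.integral_ne i j hij]
  simp

variable (𝕜 K) in
/-- The partial sums of the random series `∑ⱼ ηⱼ cⱼ`. -/
def IsOrthonormalSeq.partialSum (c : ℕ → K) (N : ℕ) : Lp K 2 P :=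
  ∑ j ∈ Finset.range N, smulLp 𝕜 K (hη.memLp j) (c j)

variable (𝕜 K) in
/-- The random series `∑ⱼ ηⱼ cⱼ` in `L²(Ω; K)`. -/
def IsOrthonormalSeq.series (c : ℕ → K) : Lp K 2 P := ∑' j, smulLp 𝕜 K (hη.memLp j) (c j)

theorem IsOrthonormalSeq.coeFn_partialSum (c : ℕ → K) (N : ℕ) :
    hη.partialSum 𝕜 K c N =ᵐ[P] fun o => ∑ j ∈ Finset.range N, η j o • c j := by
  induction N with
  | zero =>
    rw [show hη.partialSum 𝕜 K c 0 = 0 by simp [IsOrthonormalSeq.partialSum]]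
    filter_upwards [Lp.coeFn_zero K 2 P] with o ho
    simpa using ho
  | succ n ih =>
    rw [IsOrthonormalSeq.partialSum, Finset.sum_range_succ]
    filter_upwards [Lp.coeFn_add (hη.partialSum 𝕜 K c n) (smulLp 𝕜 K (hη.memLp n) (c n)), ih,
      coeFn_smulLp (𝕜 := 𝕜) (hη.memLp n) (c n)] with o h1 h2 h3
    rw [Finset.sum_range_succ, ← h2, ← h3]
    exact h1

theorem IsOrthonormalSeq.norm_partialSum_sub_sq (c : ℕ → K) {N M : ℕ} (h : N ≤ M) :
    ‖hη.partialSum 𝕜 K c M - hη.partialSum 𝕜 K c N‖ ^ 2 =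
      ∑ j ∈ Finset.range M, ‖c j‖ ^ 2 - ∑ j ∈ Finset.range N, ‖c j‖ ^ 2 := by
  rw [IsOrthonormalSeq.partialSum, IsOrthonormalSeq.partialSum, ← Finset.sum_Ico_eq_sub _ h,
    ← Finset.sum_Ico_eq_sub _ h]
  exact (hη.orthogonalFamily (𝕜 := 𝕜) (K := K)).norm_sum c _

variable [CompleteSpace K] {c : ℕ → K} (hc : Summable fun j => ‖c j‖ ^ 2)

include hc in
theorem IsOrthonormalSeq.tendsto_partialSum :
    Tendsto (hη.partialSum 𝕜 K c) atTop (𝓝 (hη.series 𝕜 K c)) := by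
  have h : Summable fun j => smulLp 𝕜 K (hη.memLp j) (c j) :=
    ((hη.orthogonalFamily (𝕜 := 𝕜) (K := K)).summable_iff_norm_sq_summable c).2 hc
  exact h.hasSum.tendsto_sum_nat

include hc in
theorem IsOrthonormalSeq.norm_series_sub_sq (N : ℕ) :
    ‖hη.series 𝕜 K c - hη.partialSum 𝕜 K c N‖ ^ 2 =
      ∑' j, ‖c j‖ ^ 2 - ∑ j ∈ Finset.range N, ‖c j‖ ^ 2 := by
  have h1 := ((hη.tendsto_partialSum (𝕜 := 𝕜) hc).sub_const (hη.partialSum 𝕜 K c N)).norm.pow 2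
  have h2 := hc.hasSum.tendsto_sum_nat.sub_const (∑ j ∈ Finset.range N, ‖c j‖ ^ 2)
  refine tendsto_nhds_unique h1 (h2.congr' ?_)
  filter_upwards [eventually_ge_atTop N] with M hM
  exact (hη.norm_partialSum_sub_sq c hM).symm

/-- Uniform convergence of a family of random series whose variance is continuous in the
parameter. -/
theorem IsOrthonormalSeq.eventually_norm_series_sub_le {α : Type*} [TopologicalSpace α]
    {s : Set α} (hs : IsCompact s) {C : ℕ → α → K} (hC : ∀ j, ContinuousOn (C j) s) {G : α → ℝ}
    (hG : ContinuousOn G s) (hsum : ∀ t ∈ s, HasSum (fun j => ‖C j t‖ ^ 2) (G t)) {ε : ℝ}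
    (hε : 0 < ε) : ∀ᶠ N in atTop, ∀ t ∈ s,
      ‖hη.series 𝕜 K (fun j => C j t) - hη.partialSum 𝕜 K (fun j => C j t) N‖ ≤ ε := by
  -- Dini's theorem: the partial sums are continuous and increasing, and their limit `G` is
  -- continuous on a compact set. The tails, which are the squared `L²(Ω)` errors, are then
  -- uniformly small.
  have h1 : TendstoUniformlyOn (fun N t => ∑ j ∈ Finset.range N, ‖C j t‖ ^ 2) G atTop s := by
    refine Monotone.tendstoUniformlyOn_of_forall_tendsto hs
      (fun N => continuousOn_finsetSum _ fun j _ => (hC j).norm.pow 2) (fun t _ => ?_) hG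
      fun t ht => (hsum t ht).tendsto_sum_nat
    exact monotone_nat_of_le_succ fun n => by
      rw [Finset.sum_range_succ]
      exact le_add_of_nonneg_right (by positivity)
  rw [Metric.tendstoUniformlyOn_iff] at h1
  filter_upwards [h1 (ε ^ 2) (by positivity)] with N hN t ht
  refine abs_le_of_sq_le_sq' ?_ hε.le |>.2
  rw [hη.norm_series_sub_sq (hsum t ht).summable, (hsum t ht).tsum_eq]
  exact (le_abs_self _).trans (hN t ht).le

end GaussianSeries

/-! ### Measurability and square integrability from the Hilbert-Schmidt norm. -/

section DerivativeIntegrability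

variable {𝕜 : Type*} [RCLike 𝕜] {H : Type*} [NormedAddCommGroup H] [InnerProductSpace 𝕜 H]
  [CompleteSpace H]

theorem measurable_hsNormSq [TopologicalSpace.SeparableSpace H] {α : Type*} [MeasurableSpace α]
    {K : α → H →L[𝕜] H} (hK : StronglyMeasurable K) : Measurable fun a => hsNormSq (K a) := by
  obtain ⟨e, he⟩ := exists_hilbertBasis_hsNormSq 𝕜 H
  have := e.orthonormal.countable_of_separableSpace
  simp_rw [he]
  refine Measurable.tsum fun i => ?_
  exact (((ContinuousLinearMap.apply 𝕜 H (e i)).continuous.comp_stronglyMeasurable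
    hK).enorm).pow_const 2

theorem memLp_two_of_lintegral_hsNormSq {α : Type*} [MeasurableSpace α] {μ : Measure α}
    {K : α → H →L[𝕜] H} (hK : AEStronglyMeasurable K μ) (h : ∫⁻ a, hsNormSq (K a) ∂μ < ⊤) :
    MemLp K 2 μ := by
  refine ⟨hK, ?_⟩
  have h1 : eLpNorm K 2 μ ^ 2 < ⊤ := by
    rw [eLpNorm_two_sq]
    exact (lintegral_mono fun a => enorm_sq_le_hsNormSq (K a)).trans_lt h
  simpa using h1

end DerivativeIntegrability

/-! ### The variation of constants formula. -/

noncomputable section InhomogeneousProblem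

variable {𝕜 : Type*} [RCLike 𝕜] {H : Type*} [NormedAddCommGroup H] [InnerProductSpace 𝕜 H]
  [NormedSpace ℝ H] [IsScalarTower ℝ 𝕜 H] [CompleteSpace H]
  {A : H →ₗ.[𝕜] H} {T : ℝ → domClosure A →L[𝕜] domClosure A} {w p : ℝ}
  (hA : AlmostSectorialAssumption A T w p) {l m τ : ℝ}

include hA

theorem AlmostSectorialAssumption.differentiableAt {t : ℝ} (ht : 0 < t) :
    DifferentiableAt ℝ T t := hA.analytic.differentiableAt ht

theorem AlmostSectorialAssumption.deriv_apply (hl : w < l) {t : ℝ} (ht : 0 < t) (x : H) :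
    deriv (integratedSemigroup A T) t x = (resolventOrbit A T (l : 𝕜) t x : domClosure A) :=
  deriv_integratedSemigroup_apply hA.semigroup (fun _ => hA.differentiableAt) hA.generator
    hA.resolvent hl ht x

/-- Two parameters are kept apart so that `m` can tend to infinity while the kernel is written with
a fixed `l`. -/
theorem AlmostSectorialAssumption.semigroup_apply_opResolventClosure (hl : w < l) (hm : w < m)
    {t : ℝ} (ht : 0 < t) (x : H) : T t (opResolventClosure A (m : 𝕜) x) =
      opResolventClosure A (m : 𝕜) (resolventOrbit A T (l : 𝕜) t x : domClosure A) := by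
  rw [resolventOrbit_congr hA.semigroup (fun _ => hA.differentiableAt) hA.generator
    hA.resolvent hl hm ht, opResolventClosure_resolventOrbit hA.semigroup
    (fun _ => hA.differentiableAt) hA.generator (hA.resolvent m hm) ht]

/-- The hypothesis concerns an `H`-valued kernel, whereas the orbit takes values in `H₀`. The norm
bound transfers pointwise; measurability is obtained afresh, the orbit being a derivative. -/
theorem AlmostSectorialAssumption.intervalIntegrable_resolventOrbit (hl : w < l)
    (hV : MemLp (deriv (integratedSemigroup A T)) 2 (volume.restrict (Icc 0 τ))) {t : ℝ}
    (ht : t ∈ Icc 0 τ) : IntervalIntegrable (resolventOrbit A T (l : 𝕜)) volume 0 t := by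
  have h1 : IntegrableOn (deriv (integratedSemigroup A T)) (Ioc 0 t) :=
    (hV.integrable one_le_two).mono_measure
      (Measure.restrict_mono (Ioc_subset_Icc_self.trans (Icc_subset_Icc_right ht.2)) le_rfl)
  rw [intervalIntegrable_iff_integrableOn_Ioc_of_le ht.1]
  refine Integrable.mono h1 ?_ ?_
  · refine (stronglyMeasurable_deriv (resolventIntegral A T (l : 𝕜))).aestronglyMeasurable.congr ?_
    filter_upwards [ae_restrict_mem measurableSet_Ioc] with s hs
    exact (hasDerivAt_resolventIntegral hA.semigroup (fun _ => hA.differentiableAt) hs.1).deriv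
  · filter_upwards [ae_restrict_mem measurableSet_Ioc] with s hs
    refine ContinuousLinearMap.opNorm_le_bound _ (norm_nonneg _) fun x => ?_
    rw [Submodule.coe_norm, ← hA.deriv_apply hl hs.1]
    exact ContinuousLinearMap.le_opNorm _ _

variable (hV : MemLp (deriv (integratedSemigroup A T)) 2 (volume.restrict (Icc 0 τ)))
  (hl : w < l)

-- The convolution lemmas ask for a function that is bounded and continuous on the whole line; `f`
-- is extended by its endpoint values.
omit hA [CompleteSpace H] in
theorem exists_bounded_continuous_extension {f : ℝ → H} (hτ : 0 ≤ τ)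
    (hf : ContinuousOn f (Icc 0 τ)) : ∃ g : ℝ → H, Continuous g ∧ (∃ C, ∀ s, ‖g s‖ ≤ C) ∧
      EqOn f g (Icc 0 τ) := by
  obtain ⟨C, hC⟩ := isCompact_Icc.exists_bound_of_continuousOn hf
  refine ⟨IccExtend hτ ((Icc 0 τ).domRestrict f),
    (continuousOn_iff_continuous_domRestrict.1 hf).Icc_extend',
    ⟨C, fun s => hC _ (projIcc 0 τ hτ s).2⟩, fun s hs => ?_⟩
  rw [IccExtend_of_mem hτ _ hs]
  rfl

omit hA in
theorem orbitConvolution_eq {f g : ℝ → H} {t : ℝ} (ht : t ∈ Icc 0 τ)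
    (hfg : EqOn f g (Icc 0 τ)) : orbitConvolution A T (l : 𝕜) f t =
      ∫ s in (0 : ℝ)..t, resolventOrbit A T (l : 𝕜) s (g (t - s)) := by
  have h := intervalIntegral.integral_comp_sub_left (a := 0) (b := t)
    (fun s => resolventOrbit A T (l : 𝕜) s (g (t - s))) t
  simp only [sub_sub_cancel, sub_self, sub_zero] at h
  rw [← h, orbitConvolution]
  refine intervalIntegral.integral_congr fun s hs => ?_
  rw [uIcc_of_le ht.1] at hs
  rw [hfg ⟨hs.1, hs.2.trans ht.2⟩]

include hV hl

theorem AlmostSectorialAssumption.continuousOn_orbitConvolution {f : ℝ → H} (hτ : 0 ≤ τ)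
    (hf : ContinuousOn f (Icc 0 τ)) :
    ContinuousOn (orbitConvolution A T (l : 𝕜) f) (Icc 0 τ) := by
  obtain ⟨g, hg, ⟨C, hC⟩, hfg⟩ := exists_bounded_continuous_extension hτ hf
  refine (continuousOn_convolution (hA.intervalIntegrable_resolventOrbit hl hV ⟨hτ, le_rfl⟩)
    hg hC).congr fun t ht => orbitConvolution_eq ht hfg

theorem AlmostSectorialAssumption.orbitConvolution_identity {f : ℝ → H} (hm : w < m)
    (hf : ContinuousOn f (Icc 0 τ)) {t : ℝ} (ht : t ∈ Icc 0 τ) :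
    ∫ r in (0 : ℝ)..t, orbitConvolution A T (l : 𝕜) f r = opResolventClosure A (m : 𝕜)
      ((m : 𝕜) • ((∫ r in (0 : ℝ)..t, orbitConvolution A T (l : 𝕜) f r : domClosure A) : H)
        + (∫ s in (0 : ℝ)..t, f s) - (orbitConvolution A T (l : 𝕜) f t : domClosure A)) := by
  obtain ⟨g, hg, ⟨C, hC⟩, hfg⟩ := exists_bounded_continuous_extension (ht.1.trans ht.2) hf
  have h1 : ∫ r in (0 : ℝ)..t, orbitConvolution A T (l : 𝕜) f r = ∫ r in (0 : ℝ)..t,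
      ∫ s in (0 : ℝ)..r, resolventOrbit A T (l : 𝕜) s (g (r - s)) := by
    refine intervalIntegral.integral_congr fun r hr => ?_
    rw [uIcc_of_le ht.1] at hr
    exact orbitConvolution_eq ⟨hr.1, hr.2.trans ht.2⟩ hfg
  have h2 : ∫ s in (0 : ℝ)..t, f s = ∫ s in (0 : ℝ)..t, g s := by
    refine intervalIntegral.integral_congr fun r hr => ?_
    rw [uIcc_of_le ht.1] at hr
    exact hfg ⟨hr.1, hr.2.trans ht.2⟩
  rw [h1, h2, orbitConvolution_eq ht hfg]
  exact convolution_resolvent_identity hA.semigroup (fun _ => hA.differentiableAt) hA.generator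
    hA.resolvent hl hm ht.1 (hA.intervalIntegrable_resolventOrbit hl hV ht) hg hC

theorem AlmostSectorialAssumption.intervalIntegrable_orbit {f : ℝ → H}
    (hf : ContinuousOn f (Icc 0 τ)) {t : ℝ} (ht : t ∈ Icc 0 τ) :
    IntervalIntegrable (fun s => resolventOrbit A T (l : 𝕜) (t - s) (f s)) volume 0 t := by
  have h1 := (hA.intervalIntegrable_resolventOrbit hl hV ht).comp_sub_left t
  simp only [sub_self, sub_zero] at h1
  refine h1.symm.clm_apply_continuousOn (hf.mono ?_)
  rw [uIcc_of_le ht.1]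
  exact Icc_subset_Icc_right ht.2

theorem AlmostSectorialAssumption.orbitConvolution_sum {ι : Type*} (s : Finset ι) (a : ι → ℝ)
    {f : ι → ℝ → H} (hf : ∀ i, ContinuousOn (f i) (Icc 0 τ)) {t : ℝ} (ht : t ∈ Icc 0 τ) :
    orbitConvolution A T (l : 𝕜) (fun r => ∑ i ∈ s, a i • f i r) t =
      ∑ i ∈ s, a i • orbitConvolution A T (l : 𝕜) (f i) t := by
  have hint : ∀ i ∈ s, IntervalIntegrable
      (fun r => a i • resolventOrbit A T (l : 𝕜) (t - r) (f i r)) volume 0 t :=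
    fun i _ => (hA.intervalIntegrable_orbit hV hl (hf i) ht).smul (a i)
  simp only [orbitConvolution]
  simp_rw [← intervalIntegral.integral_smul]
  rw [← intervalIntegral.integral_finsetSum hint]
  refine intervalIntegral.integral_congr fun r _ => ?_
  simp only [map_sum]
  exact Finset.sum_congr rfl fun i _ => (resolventOrbit A T (l : 𝕜) (t - r)).map_smul_of_tower _ _

theorem AlmostSectorialAssumption.integral_deriv_apply {f : ℝ → H}
    (hf : ContinuousOn f (Icc 0 τ)) {t : ℝ} (ht : t ∈ Icc 0 τ) :
    IntervalIntegrable (fun s => deriv (integratedSemigroup A T) (t - s) (f s)) volume 0 t ∧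
      ∫ s in (0 : ℝ)..t, deriv (integratedSemigroup A T) (t - s) (f s) =
        (orbitConvolution A T (l : 𝕜) f t : domClosure A) := by
  have h1 := hA.intervalIntegrable_orbit hV hl hf ht
  have h2 : ∀ᵐ s : ℝ, s ∈ uIoc 0 t → (domClosure A).subtypeL
      (resolventOrbit A T (l : 𝕜) (t - s) (f s)) =
        deriv (integratedSemigroup A T) (t - s) (f s) := by
    -- The identification of the kernel is available only for `t - s > 0`, so the endpoint is
    -- discarded.
    have h3 : ∀ᵐ s : ℝ, s ≠ t := by simp [ae_iff]
    filter_upwards [h3] with s hs hs'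
    rw [uIoc_of_le ht.1] at hs'
    exact (hA.deriv_apply hl (sub_pos.2 (lt_of_le_of_ne hs'.2 hs)) _).symm
  refine ⟨(h1.clm_comp_of_real (domClosure A).subtypeL).congr_ae
    ((ae_restrict_iff' measurableSet_uIoc).2 h2), ?_⟩
  rw [← intervalIntegral.integral_congr_ae h2,
    (domClosure A).subtypeL.intervalIntegral_comp_comm_of_real h1]
  rfl

/-- The variation of constants formula gives the unique integrated solution. -/
theorem AlmostSectorialAssumption.isIntegratedSolution {f : ℝ → H} (hτ : 0 ≤ τ)
    (hf : ContinuousOn f (Icc 0 τ)) (ξ : domClosure A) :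
    IsIntegratedSolution A τ ξ f
      (fun t => ((T t ξ + orbitConvolution A T (l : 𝕜) f t : domClosure A) : H)) := by
  have hTc := hA.semigroup.continuousOn_apply (fun _ => hA.differentiableAt) ξ
  have hcc := hA.continuousOn_orbitConvolution hV hl hτ hf
  have hT' : ContinuousOn (fun t => T t ξ) (Icc 0 τ) := hTc.mono Icc_subset_Ici_self
  refine ⟨(domClosure A).subtypeL.continuous.comp_continuousOn (hT'.add hcc), fun t ht => ?_⟩
  have hi1 : IntervalIntegrable (fun t => T t ξ) volume 0 t :=
    (hA.semigroup.intervalIntegrable (fun _ => hA.differentiableAt) ht.1).clm_apply_const ξ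
  have hi2 : IntervalIntegrable (orbitConvolution A T (l : 𝕜) f) volume 0 t :=
    ContinuousOn.intervalIntegrable (by
      rw [uIcc_of_le ht.1]; exact hcc.mono (Icc_subset_Icc_right ht.2))
  have h1 : ∫ s in (0 : ℝ)..t, ((T s ξ + orbitConvolution A T (l : 𝕜) f s : domClosure A) : H) =
      ((∫ s in (0 : ℝ)..t, T s ξ) + ∫ s in (0 : ℝ)..t, orbitConvolution A T (l : 𝕜) f s :
        domClosure A) := by
    rw [← intervalIntegral.integral_add hi1 hi2]
    exact (domClosure A).subtypeL.intervalIntegral_comp_comm_of_real (hi1.add hi2)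
  have h2 := congrArg Subtype.val (orbit_resolvent_identity hA.semigroup
    (fun _ => hA.differentiableAt) hA.generator hA.resolvent hl ht.1 ξ)
  have h3 := congrArg Subtype.val (hA.orbitConvolution_identity hV hl hl hf ht)
  -- The sum of the two resolvent identities `h2` and `h3` is exactly the graph criterion for `∫₀ᵗ
  -- u` with value `u(t) - ξ - ∫₀ᵗ f`.
  obtain ⟨h, h4⟩ := (exists_apply_eq_iff (hA.resolvent l hl)
    (z := ∫ s in (0 : ℝ)..t, ((T s ξ + orbitConvolution A T (l : 𝕜) f s : domClosure A) : H))
    (v := ((T t ξ + orbitConvolution A T (l : 𝕜) f t : domClosure A) : H) - ξ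
      - ∫ s in (0 : ℝ)..t, f s)).2 (by
    rw [h1, Submodule.coe_add]
    refine (congrArg₂ (· + ·) h2 h3).trans ?_
    rw [coe_opResolventClosure, coe_opResolventClosure, ← map_add]
    congr 1
    simp only [Submodule.coe_add, Submodule.coe_sub, Submodule.coe_smul]
    module)
  refine ⟨h, ?_⟩
  rw [h4]
  abel

omit hV in
theorem AlmostSectorialAssumption.eqOn_of_isIntegratedSolution {f u v : ℝ → H} {x : H}
    (hu : IsIntegratedSolution A τ x f u) (hv : IsIntegratedSolution A τ x f v) :
    EqOn u v (Icc 0 τ) := by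
  intro t ht
  rw [← sub_eq_zero]
  refine eq_zero_of_integrated_homogeneous hA.semigroup (fun _ => hA.differentiableAt)
    hA.generator hA.resolvent hl (v := fun s => u s - v s) (hu.1.sub hv.1) (fun s hs => ?_) t ht
  obtain ⟨h1, h2⟩ := hu.2 s hs
  obtain ⟨h3, h4⟩ := hv.2 s hs
  have hint : ∀ {g : ℝ → H}, ContinuousOn g (Icc 0 τ) → IntervalIntegrable g volume 0 s :=
    fun hg => ContinuousOn.intervalIntegrable (by
      rw [uIcc_of_le hs.1]; exact hg.mono (Icc_subset_Icc_right hs.2))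
  have h5 := intervalIntegral.integral_sub (hint hu.1) (hint hv.1)
  simp only [h5]
  refine ⟨A.domain.sub_mem h1 h3, ?_⟩
  refine (A.map_sub ⟨_, h1⟩ ⟨_, h3⟩).trans ?_
  rw [h2, h4]
  abel

end InhomogeneousProblem

/-! ### The variance of the stochastic convolution. -/

noncomputable section VarianceIdentity

variable {𝕜 : Type*} [RCLike 𝕜] {H : Type*} [NormedAddCommGroup H] [InnerProductSpace 𝕜 H]
  [NormedSpace ℝ H] [IsScalarTower ℝ 𝕜 H] [CompleteSpace H]

/-- The kernel `s ↦ V(t - s)`, cut off outside `[0, t)`. -/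
def volterraKernel (V : ℝ → H →L[𝕜] H) (t s : ℝ) : H →L[𝕜] H := (Ioc 0 t).indicator V (t - s)

variable {V : ℝ → H →L[𝕜] H} {τ t : ℝ}

theorem volterraKernel_of_lt {s : ℝ} (h : t < s) : volterraKernel V t s = 0 := by
  rw [volterraKernel, indicator_of_notMem]
  intro h'
  linarith [h'.1]

theorem MeasureTheory.MemLp.indicator_of_restrict {α F : Type*} [MeasurableSpace α]
    {μ : Measure α} [NormedAddCommGroup F] {f : α → F} {s : Set α} (hs : MeasurableSet s)
    {q : ℝ≥0∞} (h : MemLp f q (μ.restrict s)) : MemLp (s.indicator f) q μ :=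
  (memLp_indicator_iff_restrict hs).2 h

theorem memLp_volterraKernel (hV : MemLp V 2 (volume.restrict (Icc 0 τ))) (ht : t ∈ Icc 0 τ) :
    MemLp (volterraKernel V t) 2 (volume.restrict (Icc 0 τ)) := by
  have h1 : MemLp V 2 (volume.restrict (Ioc 0 t)) := hV.mono_measure
    (Measure.restrict_mono (Ioc_subset_Icc_self.trans (Icc_subset_Icc_right ht.2)) le_rfl)
  exact ((h1.indicator_of_restrict measurableSet_Ioc).comp_measurePreserving
    (Measure.measurePreserving_sub_left volume t)).restrict _

theorem volterraKernel_apply_eq_indicator (f : ℝ → H) (s : ℝ) :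
    volterraKernel V t s (f s) = (Ico 0 t).indicator (fun s => V (t - s) (f s)) s := by
  have h : t - s ∈ Ioc 0 t ↔ s ∈ Ico 0 t := by
    simp only [mem_Ioc, mem_Ico]; constructor <;> rintro ⟨h1, h2⟩ <;> constructor <;> linarith
  by_cases hs : s ∈ Ico 0 t
  · rw [indicator_of_mem hs, volterraKernel, indicator_of_mem (h.2 hs)]
  · rw [indicator_of_notMem hs, volterraKernel, indicator_of_notMem (fun h' => hs (h.1 h'))]
    rfl

theorem integral_volterraKernel (ht : t ∈ Icc 0 τ) (f : ℝ → H) :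
    ∫ s in Icc 0 τ, volterraKernel V t s (f s) = ∫ s in (0 : ℝ)..t, V (t - s) (f s) := by
  simp_rw [volterraKernel_apply_eq_indicator]
  rw [setIntegral_indicator measurableSet_Ico, inter_eq_self_of_subset_right
    (Ico_subset_Icc_self.trans (Icc_subset_Icc_right ht.2)), intervalIntegral.integral_of_le ht.1,
    integral_Ico_eq_integral_Ioo, integral_Ioc_eq_integral_Ioo]

theorem hsNormSq_zero : hsNormSq (0 : H →L[𝕜] H) = 0 := by simp [hsNormSq]

/-- The kernel is supported in `[0, t)`, so the integral may be taken over the whole line and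
reflected by `r = t - s`. The result depends on `t` only through its endpoint, hence continuously.
-/
theorem lintegral_hsNormSq_volterraKernel (ht : t ∈ Icc 0 τ) :
    ∫⁻ s in Icc 0 τ, hsNormSq (volterraKernel V t s) = ∫⁻ r in Ioc 0 t, hsNormSq (V r) := by
  have h1 : ∀ s, hsNormSq (volterraKernel V t s) =
      (Ioc 0 t).indicator (fun r => hsNormSq (V r)) (t - s) := by
    intro s
    unfold volterraKernel
    by_cases hs : t - s ∈ Ioc 0 t
    · rw [indicator_of_mem hs, indicator_of_mem hs]
    · rw [indicator_of_notMem hs, indicator_of_notMem hs, hsNormSq_zero]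
  have h2 : ∫⁻ s in Icc 0 τ, hsNormSq (volterraKernel V t s) =
      ∫⁻ s, hsNormSq (volterraKernel V t s) := by
    rw [← lintegral_indicator measurableSet_Icc]
    congr 1
    ext s
    by_cases hs : s ∈ Icc 0 τ
    · rw [indicator_of_mem hs]
    · rw [indicator_of_notMem hs, h1, indicator_of_notMem]
      intro h
      exact hs ⟨by linarith [h.2], by linarith [h.1, ht.2]⟩
  rw [h2, lintegral_congr h1, lintegral_sub_left_eq_self
    (fun r => (Ioc 0 t).indicator (fun r => hsNormSq (V r)) r) t,
    lintegral_indicator measurableSet_Ioc]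

variable [TopologicalSpace.SeparableSpace H]
  (b : HilbertBasis ℕ 𝕜 (Lp H 2 (volume.restrict (Icc (0 : ℝ) τ)))) {φ : ℕ → ℝ → H}
  (hbφ : ∀ j, b j =ᵐ[volume.restrict (Icc (0 : ℝ) τ)] φ j)

include hbφ in
theorem hasSum_norm_integral_sq (hV : StronglyMeasurable V)
    (hV' : ∫⁻ r in Icc 0 τ, hsNormSq (V r) < ⊤) (ht : t ∈ Icc 0 τ) :
    HasSum (fun j => ‖∫ s in (0 : ℝ)..t, V (t - s) (φ j s)‖ ^ 2)
      (∫ r in (0 : ℝ)..t, (hsNormSq (V r)).toReal) := by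
  have hmem := memLp_two_of_lintegral_hsNormSq hV.aestronglyMeasurable hV'
  have h1 := tsum_enorm_integral_sq (memLp_volterraKernel hmem ht) b hbφ
  simp_rw [integral_volterraKernel ht] at h1
  have h2 : ∫⁻ r in Ioc 0 t, hsNormSq (V r) < ⊤ := (lintegral_mono_set
    (Ioc_subset_Icc_self.trans (Icc_subset_Icc_right ht.2))).trans_lt hV'
  rw [lintegral_hsNormSq_volterraKernel ht] at h1
  have hmeas := measurable_hsNormSq hV
  have h3 := ENNReal.hasSum_toReal (h1.trans_ne h2.ne)
  rw [← ENNReal.tsum_toReal_eq fun j => by finiteness, h1] at h3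
  rw [intervalIntegral.integral_of_le ht.1, integral_toReal hmeas.aemeasurable
    (ae_lt_top hmeas h2.ne)]
  simpa using h3

theorem continuousOn_integral_hsNormSq (hτ : 0 ≤ τ) (hV : StronglyMeasurable V)
    (hV' : ∫⁻ r in Icc 0 τ, hsNormSq (V r) < ⊤) :
    ContinuousOn (fun t => ∫ r in (0 : ℝ)..t, (hsNormSq (V r)).toReal) (Icc 0 τ) := by
  have h := intervalIntegral.continuousOn_primitive_interval (μ := volume)
    (f := fun r => (hsNormSq (V r)).toReal) (a := 0) (b := τ) (by
      rw [uIcc_of_le hτ]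
      exact integrable_toReal_of_lintegral_ne_top (measurable_hsNormSq hV).aemeasurable hV'.ne)
  rwa [uIcc_of_le hτ] at h

end VarianceIdentity

/-! ### Measurability with respect to the noise filtration. -/

section Adaptedness

variable {𝕜 : Type*} [RCLike 𝕜] {H : Type*} [NormedAddCommGroup H] [InnerProductSpace 𝕜 H]
  [NormedSpace ℝ H] [IsScalarTower ℝ 𝕜 H] [CompleteSpace H]
  {Ω : Type*} [MeasurableSpace Ω] {P : Measure Ω} {η : ℕ → Ω → ℝ} {τ : ℝ}
  {b : HilbertBasis ℕ 𝕜 (Lp H 2 (volume.restrict (Icc (0 : ℝ) τ)))}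

theorem measurable_noiseFiltration {t : ℝ} {ψ : Lp H 2 (volume.restrict (Icc (0 : ℝ) τ))}
    (hψ : ∀ᵐ r ∂(volume.restrict (Icc (0 : ℝ) τ)), t < r → ψ r = 0) {Y : Ω → 𝕜}
    (hY : IsWhiteNoiseValue P η b ψ Y) : Measurable[noiseFiltration P η b t] Y :=
  fun B hB => MeasurableSpace.measurableSet_generateFrom ⟨ψ, Y, B, hψ, hY, hB, rfl⟩

/-- The coefficients of the noise are measurable with respect to the final `σ`-algebra. -/
theorem measurable_coefficient (hη : ∀ j, Measurable (η j)) (hη2 : ∀ j, MemLp (η j) 2 P) (j : ℕ) :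
    Measurable[noiseFiltration P η b τ] (η j) := by
  have h1 : IsWhiteNoiseValue P η b (b j) (fun o => (η j o : 𝕜)) := by
    refine ⟨RCLike.measurable_ofReal.comp (hη j), (hη2 j).ofReal, ?_⟩
    refine tendsto_const_nhds.congr' ?_
    -- By orthonormality the partial sums of the white noise at `b j` equal `η j` exactly as soon as
    -- `N > j`.
    filter_upwards [eventually_gt_atTop j] with N hN
    have h2 : ∀ o, (∑ i ∈ Finset.range N, (η i o : 𝕜) * inner 𝕜 (b i) (b j)) - (η j o : 𝕜) = 0 := by
      intro o
      rw [Finset.sum_eq_single j]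
      · rw [inner_self_eq_norm_sq_to_K, b.orthonormal.1 j]; simp
      · intro i _ hij
        rw [b.orthonormal.2 hij, mul_zero]
      · intro h
        exact absurd (Finset.mem_range.2 hN) h
    simp [h2]
  have h2 : ∀ᵐ r ∂(volume.restrict (Icc (0 : ℝ) τ)), τ < r → b j r = 0 := by
    filter_upwards [ae_restrict_mem measurableSet_Icc] with r hr h
    exact absurd hr.2 (not_le.2 h)
  have h3 := RCLike.measurable_re.comp (measurable_noiseFiltration h2 h1)
  simpa [Function.comp_def] using h3

/-- Moving `K` to the other side of the inner product turns the `j`-th term into `ηⱼ ⟨φⱼ, K* h⟩`, so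
convergence of the stochastic integral gives that of the scalar white noise. -/
theorem isWhiteNoiseValue_inner {K : ℝ → H →L[𝕜] H}
    (hK : MemLp K 2 (volume.restrict (Icc (0 : ℝ) τ))) {φ : ℕ → ℝ → H}
    (hbφ : ∀ j, b j =ᵐ[volume.restrict (Icc (0 : ℝ) τ)] φ j) {I : Ω → H}
    (hI : StronglyMeasurable I) (hI2 : MemLp I 2 P)
    (hlim : Tendsto (fun N : ℕ => eLpNorm (fun o => (∑ j ∈ Finset.range N,
      η j o • ∫ s in Icc 0 τ, K s (φ j s)) - I o) 2 P) atTop (𝓝 0)) (h : H) :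
    IsWhiteNoiseValue P η b ((hK.adjoint_apply h).toLp _) (fun o => inner 𝕜 (I o) h) := by
  refine ⟨(hI.inner stronglyMeasurable_const).measurable, hI2.inner_const h, ?_⟩
  have h1 : Tendsto (fun N : ℕ => ENNReal.ofReal ‖h‖ * eLpNorm (fun o =>
      (∑ j ∈ Finset.range N, η j o • ∫ s in Icc 0 τ, K s (φ j s)) - I o) 2 P) atTop (𝓝 0) := by
    have h2 := ENNReal.Tendsto.const_mul (a := ENNReal.ofReal ‖h‖) hlim
      (Or.inr ENNReal.ofReal_ne_top)
    rwa [mul_zero] at h2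
  refine tendsto_of_tendsto_of_tendsto_of_le_of_le tendsto_const_nhds h1
    (fun N => bot_le) fun N => ?_
  refine eLpNorm_le_mul_eLpNorm_of_ae_le_mul (Eventually.of_forall fun o => ?_) 2
  have h2 : (∑ j ∈ Finset.range N, (η j o : 𝕜) * inner 𝕜 (b j) ((hK.adjoint_apply h).toLp _)) -
      inner 𝕜 (I o) h = inner 𝕜 ((∑ j ∈ Finset.range N,
        η j o • ∫ s in Icc 0 τ, K s (φ j s)) - I o) h := by
    rw [inner_sub_left, sum_inner]
    congr 1
    refine Finset.sum_congr rfl fun j _ => ?_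
    rw [RCLike.real_smul_eq_coe_smul (K := 𝕜), inner_smul_left, RCLike.conj_ofReal,
      ← inner_conj_symm (b j), inner_toLp_adjoint_apply hK h (b j) (hbφ j), inner_conj_symm]
  rw [h2, mul_comm]
  exact norm_inner_le_norm _ _

theorem stronglyMeasurable_of_measurable_inner [TopologicalSpace.SeparableSpace H]
    {m : MeasurableSpace Ω} {I : Ω → H}
    (hI : ∀ h : H, Measurable[m] fun o => (inner 𝕜 (I o) h : 𝕜)) : StronglyMeasurable[m] I := by
  obtain ⟨e, -⟩ := exists_hilbertBasis_hsNormSq 𝕜 H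
  have := e.orthonormal.countable_of_separableSpace
  have h1 : ∀ s : Finset (exists_hilbertBasis 𝕜 H).choose,
      StronglyMeasurable[m] fun o => ∑ i ∈ s, (inner 𝕜 (e i) (I o) : 𝕜) • e i := by
    intro s
    refine Finset.stronglyMeasurable_fun_sum _ fun i _ => StronglyMeasurable.smul_const ?_ _
    have h2 : Measurable[m] fun o => (starRingEnd 𝕜) (inner 𝕜 (I o) (e i)) :=
      RCLike.continuous_conj.measurable.comp (hI (e i))
    simp only [inner_conj_symm] at h2
    exact h2.stronglyMeasurable
  refine stronglyMeasurable_of_tendsto atTop h1 (tendsto_pi_nhds.2 fun o => ?_)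
  have h3 := e.hasSum_repr (I o)
  simp only [e.repr_apply_apply] at h3
  exact h3

end Adaptedness

/-! ### Operators and time integrals acting on single random terms. -/

noncomputable section SmulLp

variable {𝕜 : Type*} [RCLike 𝕜] {K K' : Type*} [NormedAddCommGroup K] [InnerProductSpace 𝕜 K]
  [NormedSpace ℝ K] [IsScalarTower ℝ 𝕜 K] [NormedAddCommGroup K'] [InnerProductSpace 𝕜 K']
  [NormedSpace ℝ K'] [IsScalarTower ℝ 𝕜 K'] {Ω : Type*} [MeasurableSpace Ω] {P : Measure Ω}

theorem compLpL_smulLp (L : K →L[𝕜] K') {f : Ω → ℝ} (hf : MemLp f 2 P) (x : K) :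
    L.compLpL 2 P (smulLp 𝕜 K hf x) = smulLp 𝕜 K' hf (L x) := by
  apply Lp.ext
  filter_upwards [L.coeFn_compLpL (p := 2) (smulLp 𝕜 K hf x), coeFn_smulLp (𝕜 := 𝕜) hf x,
    coeFn_smulLp (𝕜 := 𝕜) hf (L x)] with o h1 h2 h3
  rw [h1, h2, h3, L.map_smul_of_tower]

theorem integral_smulLp [CompleteSpace K] {f : Ω → ℝ} (hf : MemLp f 2 P)
    (h1 : ∫ o, f o * f o ∂P = 1) {u : ℝ → K} {a b : ℝ} (hu : IntervalIntegrable u volume a b) :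
    IntervalIntegrable (fun s => smulLp 𝕜 K hf (u s)) volume a b ∧
      ∫ s in a..b, smulLp 𝕜 K hf (u s) = smulLp 𝕜 K hf (∫ s in a..b, u s) :=
  ⟨hu.clm_comp_of_real (smulLpIsometry 𝕜 K hf h1).toContinuousLinearMap,
    (smulLpIsometry 𝕜 K hf h1).toContinuousLinearMap.intervalIntegral_comp_comm_of_real hu⟩

theorem continuous_smulLp {f : Ω → ℝ} (hf : MemLp f 2 P) (h1 : ∫ o, f o * f o ∂P = 1) :
    Continuous (smulLp 𝕜 K hf) := (smulLpIsometry 𝕜 K hf h1).continuous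

end SmulLp

/-! ### Passage from `H₀`-valued to `H`-valued random variables. -/

section ClosedSubspace

variable {𝕜 : Type*} [RCLike 𝕜] {H : Type*} [NormedAddCommGroup H] [InnerProductSpace 𝕜 H]
  {S : Submodule 𝕜 H} {Ω : Type*} [MeasurableSpace Ω] {P : Measure Ω}

theorem eLpNorm_coe_submodule (f : Ω → S) (q : ℝ≥0∞) :
    eLpNorm (fun o => (f o : H)) q P = eLpNorm f q P :=
  eLpNorm_congr_norm_ae (Eventually.of_forall fun _ => rfl)

theorem MeasureTheory.MemLp.coe_submodule {f : Ω → S} {q : ℝ≥0∞} (hf : MemLp f q P) :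
    MemLp (fun o => (f o : H)) q P :=
  ⟨continuous_subtype_val.comp_aestronglyMeasurable hf.1, by
    rw [eLpNorm_coe_submodule]; exact hf.2⟩

theorem memMeanSquareC_of_continuousOn {F : ℝ → MeasurableSpace Ω} {τ : ℝ} {X : ℝ → Ω → H}
    {Z : ℝ → Lp S 2 P} (hZ : ContinuousOn Z (Icc 0 τ))
    (hX : ∀ t ∈ Icc (0 : ℝ) τ, X t =ᵐ[P] fun o => (Z t o : H))
    (hm : ∀ t ∈ Icc (0 : ℝ) τ, StronglyMeasurable[F t] (X t)) : MemMeanSquareC P F τ X := by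
  refine ⟨fun t ht => ⟨hm t ht, (memLp_congr_ae (hX t ht)).2 (Lp.memLp (Z t)).coe_submodule⟩,
    fun t ht => ?_⟩
  refine (tendsto_iff_edist_tendsto_0.1 (hZ t ht)).congr' ?_
  filter_upwards [self_mem_nhdsWithin] with s hs
  rw [Lp.edist_def, ← eLpNorm_coe_submodule]
  refine eLpNorm_congr_ae ?_
  filter_upwards [hX t ht, hX s hs] with o h1 h2
  simp [h1, h2]

variable [NormedSpace ℝ H] [IsScalarTower ℝ 𝕜 H] {η : ℕ → Ω → ℝ} (hη : IsOrthonormalSeq P η)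

theorem IsOrthonormalSeq.isStochasticIntegral {φ : ℕ → ℝ → H} {t : ℝ} {Φ : ℝ → H → H} {c : ℕ → S}
    (hint : ∀ j, IntervalIntegrable (fun s => Φ s (φ j s)) volume 0 t)
    (hc : ∀ j, ∫ s in (0 : ℝ)..t, Φ s (φ j s) = c j) {J : Lp S 2 P}
    (hJ : Tendsto (hη.partialSum 𝕜 S c) atTop (𝓝 J)) {I : Ω → H}
    (hI : I =ᵐ[P] fun o => (J o : H)) : IsStochasticIntegral P η φ t Φ I := by
  refine ⟨hint, (memLp_congr_ae hI).2 (Lp.memLp J).coe_submodule, ?_⟩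
  refine (tendsto_iff_edist_tendsto_0.1 hJ).congr fun N => ?_
  rw [Lp.edist_def, ← eLpNorm_coe_submodule]
  refine eLpNorm_congr_ae ?_
  filter_upwards [hI, hη.coeFn_partialSum (𝕜 := 𝕜) c N] with o h1 h2
  simp [h1, h2, hc]

end ClosedSubspace

/-! ### The solution as a curve in `L²(Ω; H₀)`, and the equation it satisfies. -/

noncomputable section StochasticProblem

variable {𝕜 : Type*} [RCLike 𝕜] {H : Type*} [NormedAddCommGroup H] [InnerProductSpace 𝕜 H]
  [CompleteSpace H] [TopologicalSpace.SeparableSpace H] [NormedSpace ℝ H] [IsScalarTower ℝ 𝕜 H]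
  {A : H →ₗ.[𝕜] H} {T : ℝ → domClosure A →L[𝕜] domClosure A} {w p τ : ℝ}
  {Ω : Type*} [MeasurableSpace Ω] {P : Measure Ω} [IsProbabilityMeasure P]
  {η : ℕ → Ω → ℝ} (hη : IsOrthonormalSeq P η) {φ : ℕ → ℝ → H}

omit [CompleteSpace H] [TopologicalSpace.SeparableSpace H] in
theorem integral_one_mul_one : ∫ _ : Ω, (1 : ℝ) * 1 ∂P = 1 := by simp

/-- The finite-rank approximation of the solution, as a curve in `L²(Ω; H₀)`. -/
def approxCurve (A : H →ₗ.[𝕜] H) (T : ℝ → domClosure A →L[𝕜] domClosure A) (l : 𝕜)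
    (φ : ℕ → ℝ → H) (ξ : domClosure A) (N : ℕ) (t : ℝ) : Lp (domClosure A) 2 P :=
  smulLp 𝕜 (domClosure A) (memLp_const (1 : ℝ)) (T t ξ) +
    hη.partialSum 𝕜 (domClosure A) (fun j => orbitConvolution A T l (φ j) t) N

/-- The solution of the stochastic problem, as a curve in `L²(Ω; H₀)`. -/
def solutionCurve (A : H →ₗ.[𝕜] H) (T : ℝ → domClosure A →L[𝕜] domClosure A) (l : 𝕜)
    (φ : ℕ → ℝ → H) (ξ : domClosure A) (t : ℝ) : Lp (domClosure A) 2 P :=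
  smulLp 𝕜 (domClosure A) (memLp_const (1 : ℝ)) (T t ξ) +
    hη.series 𝕜 (domClosure A) (fun j => orbitConvolution A T l (φ j) t)

theorem coeFn_approxCurve (l : 𝕜) (ξ : domClosure A) (N : ℕ) (t : ℝ) :
    approxCurve hη A T l φ ξ N t =ᵐ[P] fun o =>
      T t ξ + ∑ j ∈ Finset.range N, η j o • orbitConvolution A T l (φ j) t := by
  refine (Lp.coeFn_add _ _).trans ?_
  filter_upwards [coeFn_smulLp (𝕜 := 𝕜) (memLp_const (μ := P) (p := 2) (1 : ℝ)) (T t ξ),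
    hη.coeFn_partialSum (𝕜 := 𝕜) (fun j => orbitConvolution A T l (φ j) t) N] with o h1 h2
  rw [Pi.add_apply, h1, h2, one_smul]

theorem coeFn_solutionCurve (l : 𝕜) (ξ : domClosure A) (t : ℝ) :
    solutionCurve hη A T l φ ξ t =ᵐ[P] fun o =>
      T t ξ + hη.series 𝕜 (domClosure A) (fun j => orbitConvolution A T l (φ j) t) o := by
  refine (Lp.coeFn_add _ _).trans ?_
  filter_upwards [coeFn_smulLp (𝕜 := 𝕜) (memLp_const (μ := P) (p := 2) (1 : ℝ)) (T t ξ)] with o h1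
  rw [Pi.add_apply, h1, one_smul]

variable (hA : AlmostSectorialAssumption A T w p) {l m : ℝ} (hl : w < l)
  (hV : ∫⁻ r in Icc 0 τ, hsNormSq (deriv (integratedSemigroup A T) r) < ⊤)
  (hφ : ∀ j, ContinuousOn (φ j) (Icc 0 τ))
  {b : HilbertBasis ℕ 𝕜 (Lp H 2 (volume.restrict (Icc (0 : ℝ) τ)))}
  (hbφ : ∀ j, b j =ᵐ[volume.restrict (Icc (0 : ℝ) τ)] φ j) (ξ : domClosure A)

omit [TopologicalSpace.SeparableSpace H] in
include hV in
theorem memLp_deriv_integratedSemigroup :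
    MemLp (deriv (integratedSemigroup A T)) 2 (volume.restrict (Icc 0 τ)) :=
  memLp_two_of_lintegral_hsNormSq (stronglyMeasurable_deriv _).aestronglyMeasurable hV

include hA hl hV hφ hbφ in
theorem hasSum_norm_orbitConvolution_sq {t : ℝ} (ht : t ∈ Icc 0 τ) :
    HasSum (fun j => ‖orbitConvolution A T (l : 𝕜) (φ j) t‖ ^ 2)
      (∫ r in (0 : ℝ)..t, (hsNormSq (deriv (integratedSemigroup A T) r)).toReal) := by
  have h := hasSum_norm_integral_sq b hbφ (stronglyMeasurable_deriv _) hV ht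
  simp_rw [fun j => (hA.integral_deriv_apply (memLp_deriv_integratedSemigroup hV) hl (hφ j) ht).2]
    at h
  exact h

include hA hl hV hφ in
theorem continuousOn_approxCurve (hτ : 0 ≤ τ) (N : ℕ) :
    ContinuousOn (approxCurve hη A T (l : 𝕜) φ ξ N) (Icc 0 τ) := by
  refine ContinuousOn.add ?_ ?_
  · exact (continuous_smulLp _ integral_one_mul_one).comp_continuousOn
      ((hA.semigroup.continuousOn_apply (fun _ => hA.differentiableAt) ξ).mono Icc_subset_Ici_self)
  · refine continuousOn_finsetSum _ fun j _ => ?_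
    exact (continuous_smulLp _ (hη.integral_self j)).comp_continuousOn
      (hA.continuousOn_orbitConvolution (memLp_deriv_integratedSemigroup hV) hl hτ (hφ j))

include hA hl hV hφ hbφ in
theorem eventually_norm_solutionCurve_sub_le (hτ : 0 ≤ τ) {ε : ℝ} (hε : 0 < ε) :
    ∀ᶠ N in atTop, ∀ t ∈ Icc 0 τ, ‖solutionCurve hη A T (l : 𝕜) φ ξ t -
      approxCurve hη A T (l : 𝕜) φ ξ N t‖ ≤ ε := by
  have h := hη.eventually_norm_series_sub_le (𝕜 := 𝕜) isCompact_Icc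
    (fun j => hA.continuousOn_orbitConvolution (memLp_deriv_integratedSemigroup hV) hl hτ (hφ j))
    (continuousOn_integral_hsNormSq hτ (stronglyMeasurable_deriv _) hV)
    (fun t ht => hasSum_norm_orbitConvolution_sq hA hl hV hφ hbφ ht) hε
  filter_upwards [h] with N hN t ht
  rw [solutionCurve, approxCurve, add_sub_add_left_eq_sub]
  exact hN t ht

include hA hl hV hφ hbφ in
theorem continuousOn_solutionCurve (hτ : 0 ≤ τ) :
    ContinuousOn (solutionCurve hη A T (l : 𝕜) φ ξ) (Icc 0 τ) := by
  have h : TendstoUniformlyOn (approxCurve hη A T (l : 𝕜) φ ξ) (solutionCurve hη A T (l : 𝕜) φ ξ)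
      atTop (Icc 0 τ) := by
    rw [Metric.tendstoUniformlyOn_iff]
    intro ε hε
    filter_upwards [eventually_norm_solutionCurve_sub_le hη hA hl hV hφ hbφ ξ hτ (half_pos hε)]
      with N hN t ht
    rw [dist_eq_norm]
    linarith [hN t ht]
  exact h.continuousOn (Eventually.of_forall fun N =>
    continuousOn_approxCurve hη hA hl hV hφ ξ hτ N).frequently

/-- The resolvent of `A` as an operator on `H₀`. -/
def resolventOnClosure (A : H →ₗ.[𝕜] H) (m : 𝕜) : domClosure A →L[𝕜] domClosure A :=
  (opResolventClosure A m).comp (domClosure A).subtypeL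

/-- The value of `∫₀ᵗ R(m, A) dW(s)` that is read off from a curve satisfying the integrated
equation after application of the resolvent. -/
def resolventDefect (A : H →ₗ.[𝕜] H) (m : 𝕜) (ξ : domClosure A) (Z : ℝ → Lp (domClosure A) 2 P)
    (t : ℝ) : Lp (domClosure A) 2 P :=
  (resolventOnClosure A m).compLpL 2 P (Z t) -
    smulLp 𝕜 (domClosure A) (memLp_const (1 : ℝ)) (resolventOnClosure A m ξ) -
    m • (resolventOnClosure A m).compLpL 2 P (∫ s in (0 : ℝ)..t, Z s) + ∫ s in (0 : ℝ)..t, Z s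

-- Everything is linear in the noise: the deterministic part cancels by the orbit identity, and the
-- coefficient of each `ηⱼ` is evaluated by the convolution identity with `f = φⱼ`.
include hA hl hV hφ in
theorem resolventDefect_approxCurve (hτ : 0 ≤ τ) (hm : w < m) {t : ℝ} (ht : t ∈ Icc 0 τ) (N : ℕ) :
    resolventDefect A (m : 𝕜) ξ (approxCurve hη A T (l : 𝕜) φ ξ N) t =
      hη.partialSum 𝕜 (domClosure A)
        (fun j => opResolventClosure A (m : 𝕜) (∫ s in (0 : ℝ)..t, φ j s)) N := by
  set R := resolventOnClosure A (m : 𝕜) with hR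
  set c : ℕ → ℝ → domClosure A := fun j => orbitConvolution A T (l : 𝕜) (φ j) with hc
  have hV' := memLp_deriv_integratedSemigroup hV
  have hi1 : IntervalIntegrable (fun s => T s ξ) volume 0 t :=
    (hA.semigroup.intervalIntegrable (fun _ => hA.differentiableAt) ht.1).clm_apply_const ξ
  have hi2 : ∀ j, IntervalIntegrable (c j) volume 0 t := fun j =>
    ContinuousOn.intervalIntegrable (by
      rw [uIcc_of_le ht.1]
      exact (hA.continuousOn_orbitConvolution hV' hl hτ (hφ j)).mono (Icc_subset_Icc_right ht.2))
  obtain ⟨hj1, hj1'⟩ := integral_smulLp (𝕜 := 𝕜) (memLp_const (μ := P) (p := 2) (1 : ℝ))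
    integral_one_mul_one hi1
  have hj2 := fun j => integral_smulLp (𝕜 := 𝕜) (hη.memLp j) (hη.integral_self j) (hi2 j)
  have hint : ∫ s in (0 : ℝ)..t, approxCurve hη A T (l : 𝕜) φ ξ N s =
      smulLp 𝕜 (domClosure A) (memLp_const (1 : ℝ)) (∫ s in (0 : ℝ)..t, T s ξ) +
        ∑ j ∈ Finset.range N, smulLp 𝕜 (domClosure A) (hη.memLp j) (∫ s in (0 : ℝ)..t, c j s) := by
    have h1 : IntervalIntegrable (fun s => ∑ j ∈ Finset.range N,
        smulLp 𝕜 (domClosure A) (hη.memLp j) (c j s)) volume 0 t := by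
      have h := IntervalIntegrable.sum (Finset.range N) fun j _ => (hj2 j).1
      rwa [Finset.sum_fn] at h
    refine (intervalIntegral.integral_add hj1 h1).trans ?_
    rw [hj1', intervalIntegral.integral_finsetSum fun j _ => (hj2 j).1]
    simp_rw [fun j => (hj2 j).2]
  have key0 : R (T t ξ) - R ξ - (m : 𝕜) • R (∫ s in (0 : ℝ)..t, T s ξ) +
      ∫ s in (0 : ℝ)..t, T s ξ = 0 := by
    have h1 := orbit_resolvent_identity hA.semigroup (fun _ => hA.differentiableAt)
      hA.generator hA.resolvent hm ht.1 ξ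
    have h2 : (∫ s in (0 : ℝ)..t, T s ξ) =
        R ((m : 𝕜) • (∫ s in (0 : ℝ)..t, T s ξ) - (T t ξ - ξ)) := h1
    nth_rewrite 2 [h2]
    simp only [map_sub, map_smul]
    abel
  have keyj : ∀ j, opResolventClosure A (m : 𝕜) (∫ s in (0 : ℝ)..t, φ j s) =
      R (c j t) - (m : 𝕜) • R (∫ s in (0 : ℝ)..t, c j s) + ∫ s in (0 : ℝ)..t, c j s := by
    intro j
    have h1 := hA.orbitConvolution_identity hV' hl hm (hφ j) ht
    rw [map_sub, map_add, map_smul] at h1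
    have h2 : (∫ s in (0 : ℝ)..t, c j s) = (m : 𝕜) • R (∫ s in (0 : ℝ)..t, c j s) +
      opResolventClosure A (m : 𝕜) (∫ s in (0 : ℝ)..t, φ j s) - R (c j t) := h1
    nth_rewrite 2 [h2]
    abel
  have key0' := congrArg (smulLp 𝕜 (domClosure A) (memLp_const (μ := P) (p := 2) (1 : ℝ))) key0
  simp only [map_add, map_sub, map_smul, map_zero] at key0'
  rw [resolventDefect, hint]
  simp only [approxCurve, IsOrthonormalSeq.partialSum, keyj, map_add, map_sub, map_smul, map_sum,
    compLpL_smulLp, ← hR, smul_add, Finset.smul_sum, Finset.sum_add_distrib,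
    Finset.sum_sub_distrib]
  rw [← sub_eq_zero]
  refine Eq.trans ?_ key0'
  abel

-- The defect involves only bounded operators and a time integral, so it passes to the uniform
-- limit. Existence of `∫₀ᵗ R(m, A) dW` thus comes as a by-product, with no separate summability
-- estimate.
include hA hl hV hφ hbφ in
theorem tendsto_partialSum_resolventDefect (hτ : 0 ≤ τ) (hm : w < m) {t : ℝ} (ht : t ∈ Icc 0 τ) :
    Tendsto (hη.partialSum 𝕜 (domClosure A)
        (fun j => opResolventClosure A (m : 𝕜) (∫ s in (0 : ℝ)..t, φ j s))) atTop
      (𝓝 (resolventDefect A (m : 𝕜) ξ (solutionCurve hη A T (l : 𝕜) φ ξ) t)) := by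
  have hU := fun ε (hε : 0 < ε) =>
    eventually_norm_solutionCurve_sub_le hη hA hl hV hφ hbφ ξ hτ (ε := ε) hε
  have h1 : Tendsto (fun N => approxCurve hη A T (l : 𝕜) φ ξ N t) atTop
      (𝓝 (solutionCurve hη A T (l : 𝕜) φ ξ t)) := by
    rw [Metric.tendsto_nhds]
    intro ε hε
    filter_upwards [hU (ε / 2) (half_pos hε)] with N hN
    rw [dist_comm, dist_eq_norm]
    linarith [hN t ht]
  have hint : ∀ {Z : ℝ → Lp (domClosure A) 2 P}, ContinuousOn Z (Icc 0 τ) →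
      IntervalIntegrable Z volume 0 t := fun hZ => ContinuousOn.intervalIntegrable (by
    rw [uIcc_of_le ht.1]; exact hZ.mono (Icc_subset_Icc_right ht.2))
  have h2 : Tendsto (fun N => ∫ s in (0 : ℝ)..t, approxCurve hη A T (l : 𝕜) φ ξ N s) atTop
      (𝓝 (∫ s in (0 : ℝ)..t, solutionCurve hη A T (l : 𝕜) φ ξ s)) := by
    rw [Metric.tendsto_nhds]
    intro ε hε
    have ht0 := ht.1
    -- Dividing by `t + 1` rather than `t` covers `t = 0` and makes the final bound strict.
    filter_upwards [hU (ε / (t + 1)) (by positivity)] with N hN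
    rw [dist_comm, dist_eq_norm, ← intervalIntegral.integral_sub
      (hint (continuousOn_solutionCurve hη hA hl hV hφ hbφ ξ hτ))
      (hint (continuousOn_approxCurve hη hA hl hV hφ ξ hτ N))]
    refine (intervalIntegral.norm_integral_le_of_norm_le_const (C := ε / (t + 1))
      fun s hs => ?_).trans_lt ?_
    · rw [uIoc_of_le ht0] at hs
      exact hN s ⟨hs.1.le, hs.2.trans ht.2⟩
    · rw [sub_zero, abs_of_nonneg ht0, div_mul_eq_mul_div, div_lt_iff₀ (by positivity)]
      linarith
  have hRc := ((resolventOnClosure A (m : 𝕜)).compLpL 2 P).continuous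
  refine Tendsto.congr (fun N => resolventDefect_approxCurve hη hA hl hV hφ ξ hτ hm ht N) ?_
  exact ((((hRc.tendsto _).comp h1).sub_const _).sub (((hRc.tendsto _).comp h2).const_smul _)).add h2

end StochasticProblem

/-! ### Mild, integrated and regularized forms of the solution. -/

section StochasticProblem

variable {𝕜 : Type*} [RCLike 𝕜] {H : Type*} [NormedAddCommGroup H] [InnerProductSpace 𝕜 H]
  [CompleteSpace H] [TopologicalSpace.SeparableSpace H] [NormedSpace ℝ H] [IsScalarTower ℝ 𝕜 H]
  {A : H →ₗ.[𝕜] H} {T : ℝ → domClosure A →L[𝕜] domClosure A} {w p τ : ℝ}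
  {Ω : Type*} [MeasurableSpace Ω] {P : Measure Ω} [IsProbabilityMeasure P]
  {η : ℕ → Ω → ℝ} (hη : IsOrthonormalSeq P η) {φ : ℕ → ℝ → H}
  (hA : AlmostSectorialAssumption A T w p) {l m : ℝ} (hl : w < l)
  (hV : ∫⁻ r in Icc 0 τ, hsNormSq (deriv (integratedSemigroup A T) r) < ⊤)
  (hφ : ∀ j, ContinuousOn (φ j) (Icc 0 τ))
  {b : HilbertBasis ℕ 𝕜 (Lp H 2 (volume.restrict (Icc (0 : ℝ) τ)))}
  (hbφ : ∀ j, b j =ᵐ[volume.restrict (Icc (0 : ℝ) τ)] φ j) (ξ : domClosure A)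

include hA hl hV hφ hbφ in
theorem isStochasticIntegral_series {t : ℝ} (ht : t ∈ Icc 0 τ) :
    IsStochasticIntegral P η φ t (fun s x => deriv (integratedSemigroup A T) (t - s) x)
      (fun o => ((hη.series 𝕜 (domClosure A)
        (fun j => orbitConvolution A T (l : 𝕜) (φ j) t) o : domClosure A) : H)) := by
  have hV' := memLp_deriv_integratedSemigroup hV
  exact hη.isStochasticIntegral (fun j => (hA.integral_deriv_apply hV' hl (hφ j) ht).1)
    (fun j => (hA.integral_deriv_apply hV' hl (hφ j) ht).2)
    (hη.tendsto_partialSum (hasSum_norm_orbitConvolution_sq hA hl hV hφ hbφ ht).summable)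
    EventuallyEq.rfl

-- Each pairing with `h` is a version of the white noise at `s ↦ V(t - s)* h`, which vanishes for `s
-- > t`. The filtration contains all versions, so the chosen representative needs no modification.
include hA hl hV hφ hbφ in
theorem stronglyMeasurable_series {t : ℝ} (ht : t ∈ Icc 0 τ) :
    StronglyMeasurable[noiseFiltration P η b t] (fun o => ((hη.series 𝕜 (domClosure A)
      (fun j => orbitConvolution A T (l : 𝕜) (φ j) t) o : domClosure A) : H)) := by
  have hV' := memLp_deriv_integratedSemigroup hV
  obtain ⟨-, h2, h3⟩ := isStochasticIntegral_series hη hA hl hV hφ hbφ ht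
  simp_rw [← integral_volterraKernel ht] at h3
  refine stronglyMeasurable_of_measurable_inner (𝕜 := 𝕜) fun h => ?_
  refine measurable_noiseFiltration ?_ (isWhiteNoiseValue_inner (memLp_volterraKernel hV' ht) hbφ
    (continuous_subtype_val.comp_stronglyMeasurable (Lp.stronglyMeasurable _)) h2 h3 h)
  filter_upwards [((memLp_volterraKernel hV' ht).adjoint_apply h).coeFn_toLp] with s hs hts
  rw [hs, volterraKernel_of_lt hts]
  simp

-- Off the endpoint, `T(t - s) m R(m, A) = m R(m, A) V(t - s)`. The bounded operator `m R(m, A)`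
-- comes out of the time integrals and the series, so one random variable serves all `m`.
include hA hl hV hφ hbφ in
theorem isStochasticIntegral_regularized (hm : w < m) {t : ℝ} (ht : t ∈ Icc 0 τ) :
    IsStochasticIntegral P η φ t
      (fun s x => T (t - s) ((m : 𝕜) • opResolventClosure A (m : 𝕜) x))
      (fun o => (((m : 𝕜) • resolventOnClosure A (m : 𝕜) (hη.series 𝕜 (domClosure A)
        (fun j => orbitConvolution A T (l : 𝕜) (φ j) t) o) : domClosure A) : H)) := by
  have hV' := memLp_deriv_integratedSemigroup hV
  set R : domClosure A →L[𝕜] domClosure A := (m : 𝕜) • resolventOnClosure A (m : 𝕜) with hR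
  have h1 : ∀ j, IntervalIntegrable
      (fun s => resolventOrbit A T (l : 𝕜) (t - s) (φ j s)) volume 0 t := fun j =>
    hA.intervalIntegrable_orbit hV' hl (hφ j) ht
  set R' : domClosure A →L[𝕜] H := (domClosure A).subtypeL.comp R with hR'
  have h2 : ∀ j, ∀ᵐ s : ℝ, s ∈ uIoc 0 t →
      R' (resolventOrbit A T (l : 𝕜) (t - s) (φ j s)) =
        T (t - s) ((m : 𝕜) • opResolventClosure A (m : 𝕜) (φ j s)) := by
    intro j
    have h3 : ∀ᵐ s : ℝ, s ≠ t := by simp [ae_iff]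
    filter_upwards [h3] with s hs hs'
    rw [uIoc_of_le ht.1] at hs'
    rw [map_smul, hA.semigroup_apply_opResolventClosure hl hm
      (sub_pos.2 (lt_of_le_of_ne hs'.2 hs))]
    rfl
  refine hη.isStochasticIntegral
    (c := fun j => R (orbitConvolution A T (l : 𝕜) (φ j) t)) (J := R.compLpL 2 P
      (hη.series 𝕜 (domClosure A) fun j => orbitConvolution A T (l : 𝕜) (φ j) t))
    (fun j => ?_) (fun j => ?_) ?_ ?_
  · exact ((h1 j).clm_comp_of_real R').congr_ae ((ae_restrict_iff' measurableSet_uIoc).2 (h2 j))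
  · rw [← intervalIntegral.integral_congr_ae (h2 j), R'.intervalIntegral_comp_comm_of_real (h1 j)]
    rfl
  · have h4 := ((R.compLpL 2 P).continuous.tendsto _).comp (hη.tendsto_partialSum (𝕜 := 𝕜)
      (hasSum_norm_orbitConvolution_sq hA hl hV hφ hbφ ht).summable)
    refine h4.congr fun N => ?_
    simp only [Function.comp_apply, IsOrthonormalSeq.partialSum, map_sum, compLpL_smulLp]
  · filter_upwards [R.coeFn_compLpL (p := 2) (hη.series 𝕜 (domClosure A) fun j =>
      orbitConvolution A T (l : 𝕜) (φ j) t)] with o ho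
    rw [ho]
    rfl

include hA hl hV hφ hbφ in
theorem isIntegratedSolutionWithNoise_of_ae_eq (hτ : 0 ≤ τ) {X : ℝ → Ω → H}
    (hX : ∀ t ∈ Icc (0 : ℝ) τ,
      X t =ᵐ[P] fun o => (solutionCurve hη A T (l : 𝕜) φ ξ t o : H)) :
    IsIntegratedSolutionWithNoise P η φ A w τ ξ X := by
  set Z := solutionCurve hη A T (l : 𝕜) φ ξ with hZ
  have hZc : ContinuousOn Z (Icc 0 τ) := continuousOn_solutionCurve hη hA hl hV hφ hbφ ξ hτ
  set J : Lp (domClosure A) 2 P →L[𝕜] Lp H 2 P := (domClosure A).subtypeL.compLpL 2 P with hJ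
  refine ⟨fun s => J (Z s), J.continuous.comp_continuousOn hZc, fun s hs => ?_, fun m hm t ht => ?_⟩
  · filter_upwards [hX s hs, (domClosure A).subtypeL.coeFn_compLpL (p := 2) (Z s)] with o h1 h2
    rw [h1]
    exact h2
  have hφt : ∀ j, IntervalIntegrable (φ j) volume 0 t := fun j =>
    ContinuousOn.intervalIntegrable (by
      rw [uIcc_of_le ht.1]; exact (hφ j).mono (Icc_subset_Icc_right ht.2))
  have hZt : IntervalIntegrable Z volume 0 t := ContinuousOn.intervalIntegrable (by
    rw [uIcc_of_le ht.1]; exact hZc.mono (Icc_subset_Icc_right ht.2))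
  -- The stochastic integral of the resolvent is taken to be the defect itself, so the equation
  -- reduces to an identity between representatives.
  refine ⟨fun o => (resolventDefect A (m : 𝕜) ξ Z t o : H), hη.isStochasticIntegral
    (c := fun j => opResolventClosure A (m : 𝕜) (∫ s in (0 : ℝ)..t, φ j s))
    (fun j => (hφt j).clm_comp_of_real _)
    (fun j => (opResolvent A (m : 𝕜)).intervalIntegral_comp_comm_of_real (hφt j))
    (tendsto_partialSum_resolventDefect hη hA hl hV hφ hbφ ξ hτ hm ht) EventuallyEq.rfl, ?_⟩
  have hJI := J.intervalIntegral_comp_comm_of_real hZt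
  set R := resolventOnClosure A (m : 𝕜) with hR
  set I : Lp (domClosure A) 2 P := ∫ s in (0 : ℝ)..t, Z s with hI
  have hdef : resolventDefect A (m : 𝕜) ξ Z t =ᵐ[P] fun o =>
      R (Z t o) - R ξ - (m : 𝕜) • R (I o) + I o := by
    unfold resolventDefect
    rw [← hR, ← hI]
    filter_upwards [Lp.coeFn_add (R.compLpL 2 P (Z t) - smulLp 𝕜 (domClosure A)
        (memLp_const (1 : ℝ)) (R ξ) - (m : 𝕜) • R.compLpL 2 P I) I,
      Lp.coeFn_sub (R.compLpL 2 P (Z t) - smulLp 𝕜 (domClosure A)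
        (memLp_const (1 : ℝ)) (R ξ)) ((m : 𝕜) • R.compLpL 2 P I),
      Lp.coeFn_sub (R.compLpL 2 P (Z t)) (smulLp 𝕜 (domClosure A)
        (memLp_const (1 : ℝ)) (R ξ)),
      Lp.coeFn_smul (m : 𝕜) (R.compLpL 2 P I), R.coeFn_compLpL (p := 2) (Z t),
      R.coeFn_compLpL (p := 2) I,
      coeFn_smulLp (𝕜 := 𝕜) (memLp_const (μ := P) (p := 2) (1 : ℝ)) (R ξ)]
      with o h1 h2 h3 h4 h5 h6 h7
    rw [h1, Pi.add_apply, h2, Pi.sub_apply, h3, Pi.sub_apply, h4, Pi.smul_apply, h5, h6, h7,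
      one_smul]
  filter_upwards [hX t ht, hdef, (domClosure A).subtypeL.coeFn_compLpL (p := 2) I] with o h1 h2 h3
  have h4 : (∫ s in (0 : ℝ)..t, (fun s => J (Z s)) s : Lp H 2 P) o = ((I o : domClosure A) : H) := by
    rw [hJI]
    exact h3
  rw [apply_opResolvent (hA.resolvent m hm), h1, h2, h4]
  simp only [Submodule.coe_add, Submodule.coe_sub, Submodule.coe_smul]
  change opResolvent A (m : 𝕜) (Z t o : H) = opResolvent A (m : 𝕜) ξ +
    ((m : 𝕜) • opResolvent A (m : 𝕜) (I o : H) - (I o : H)) +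
    (opResolvent A (m : 𝕜) (Z t o : H) - opResolvent A (m : 𝕜) ξ -
      (m : 𝕜) • opResolvent A (m : 𝕜) (I o : H) + (I o : H))
  abel

omit [TopologicalSpace.SeparableSpace H] [IsProbabilityMeasure P] in
include hA in
/-- `m R(m, A) I → I` in mean square, for a square integrable `I` with values in `H₀`. -/
theorem AlmostSectorialAssumption.tendsto_eLpNorm_regularized (I : Lp (domClosure A) 2 P) :
    Tendsto (fun m : ℝ => eLpNorm (fun o => (m : 𝕜) • resolventOnClosure A (m : 𝕜) (I o) - I o) 2 P)
      atTop (𝓝 0) := by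
  obtain ⟨C, hC0, hC⟩ := exists_norm_smul_opResolventClosure_le hA.semigroup
    (fun _ => hA.differentiableAt) hA.generator hA.resolvent
  have h1 : Tendsto (fun m : ℝ =>
      ∫⁻ o, ‖(m : 𝕜) • resolventOnClosure A (m : 𝕜) (I o) - I o‖ₑ ^ 2 ∂P) atTop (𝓝 0) := by
    rw [← lintegral_zero (μ := P)]
    -- Convergence is pointwise for every outcome because `I` takes values in `H₀`; the uniform
    -- bound on `m R(m, A)` over `H₀` gives the majorant.
    refine tendsto_lintegral_filter_of_dominated_convergence
      (fun o => (ENNReal.ofReal (C + 1) * ‖I o‖ₑ) ^ 2) ?_ ?_ ?_ ?_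
    · refine Eventually.of_forall fun m => ?_
      have h2 : StronglyMeasurable fun o =>
          (m : 𝕜) • resolventOnClosure A (m : 𝕜) (I o) - I o :=
        (((resolventOnClosure A (m : 𝕜)).continuous.comp_stronglyMeasurable
          (Lp.stronglyMeasurable I)).const_smul (m : 𝕜)).sub (Lp.stronglyMeasurable I)
      exact h2.enorm.pow_const 2
    · filter_upwards [hC] with m hm
      refine Eventually.of_forall fun o => ?_
      gcongr
      rw [← ofReal_norm, ← ofReal_norm, ← ENNReal.ofReal_mul (by positivity)]
      refine ENNReal.ofReal_le_ofReal ((norm_sub_le _ _).trans ?_)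
      have := hm (I o)
      rw [add_mul, one_mul]
      gcongr
      exact this
    · simp_rw [mul_pow]
      rw [lintegral_const_mul' _ _ (by finiteness), ← eLpNorm_two_sq]
      have := Lp.eLpNorm_ne_top I
      finiteness
    · refine Eventually.of_forall fun o => ?_
      have h2 : Tendsto (fun m : ℝ => (m : 𝕜) • resolventOnClosure A (m : 𝕜) (I o) - I o) atTop
          (𝓝 (I o - I o)) := (hA.tendsto_smul_opResolventClosure (I o)).sub_const (I o)
      have h3 := ((ENNReal.continuous_pow 2).tendsto _).comp ((continuous_enorm.tendsto _).comp h2)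
      simpa [Function.comp_def] using h3
  simp_rw [← eLpNorm_two_sq] at h1
  have h2 := h1.ennrpow_const (1 / 2)
  simp_rw [← ENNReal.rpow_natCast, ← ENNReal.rpow_mul] at h2
  simpa using h2

end StochasticProblem

/-! ### Assembly of the main theorem. -/

theorem mainTheorem1 {𝕜 : Type*} [RCLike 𝕜] {H : Type*} [NormedAddCommGroup H]
    [InnerProductSpace 𝕜 H] [CompleteSpace H] [TopologicalSpace.SeparableSpace H]
    [NormedSpace ℝ H] [IsScalarTower ℝ 𝕜 H]
    (A : H →ₗ.[𝕜] H) (T : ℝ → domClosure A →L[𝕜] domClosure A) (w p : ℝ)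
    (hA : AlmostSectorialAssumption A T w p) (τ : ℝ) (hτ : 0 < τ)
    (hS : ∫⁻ r in Icc 0 τ, hsNormSq (integratedSemigroup A T r) < ⊤)
    (hS' : ∫⁻ r in Icc 0 τ, hsNormSq (deriv (integratedSemigroup A T) r) < ⊤)
    {Ω : Type*} [MeasurableSpace Ω] (P : Measure Ω) [IsProbabilityMeasure P]
    (b : HilbertBasis ℕ 𝕜 (Lp H 2 (volume.restrict (Icc (0 : ℝ) τ)))) (φ : ℕ → ℝ → H)
    (hφ : ∀ j, ContDiffOn ℝ ∞ (φ j) (Icc 0 τ))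
    (hbφ : ∀ j, b j =ᵐ[volume.restrict (Icc (0 : ℝ) τ)] φ j)
    (η : ℕ → Ω → ℝ) (hη : ∀ j, Measurable (η j)) (hlaw : ∀ j, HasLaw (η j) (gaussianReal 0 1) P)
    (hindep : iIndepFun η P) (ξ : domClosure A) :
    ∃ (XN : ℕ → ℝ → Ω → H) (X : ℝ → Ω → H),
      -- `XN N` is the integrated solution of the equation driven by the finite-rank noise
      (∀ N o, IsIntegratedSolution A τ ξ (finiteRankNoise η φ N o) (fun t => XN N t o) ∧
        ∀ u, IsIntegratedSolution A τ ξ (finiteRankNoise η φ N o) u →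
          EqOn u (fun t => XN N t o) (Icc 0 τ)) ∧
      (∀ N, MemMeanSquareC P (fun _ => noiseFiltration P η b τ) τ (XN N)) ∧
      -- convergence to an adapted process `X`
      MemMeanSquareC P (noiseFiltration P η b) τ X ∧
      Tendsto (fun N => ⨆ t ∈ Icc (0 : ℝ) τ, eLpNorm (XN N t - X t) 2 P) atTop (𝓝 0) ∧
      -- `X` solves `dX = A X dt + dW`, `X 0 = ξ`
      IsMildSolution P η φ A T τ ξ X ∧
      IsIntegratedSolutionWithNoise P η φ A w τ ξ X ∧
      -- `X t = T t ξ + lim_{l → ∞} ∫₀ᵗ T (t - s) l R(l, A) dW(s)`, a.s. and in mean square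
      ∃ Y : ℝ → ℝ → Ω → H,
        (∀ l : ℝ, w < l → ∀ t ∈ Icc (0 : ℝ) τ, IsStochasticIntegral P η φ t
          (fun s x => T (t - s) ((l : 𝕜) • opResolventClosure A (l : 𝕜) x)) (Y l t)) ∧
        ∀ t ∈ Icc (0 : ℝ) τ,
          (∀ᵐ o ∂P, ∃ L : H, Tendsto (fun l : ℝ => Y l t o) atTop (𝓝 L) ∧
            X t o = (T t ξ : H) + L) ∧
          Tendsto (fun l : ℝ => eLpNorm (fun o => (T t ξ : H) + Y l t o - X t o) 2 P)
            atTop (𝓝 0) := by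
  have hη' := isOrthonormalSeq_of_gaussian hη hlaw hindep
  have hφc : ∀ j, ContinuousOn (φ j) (Icc 0 τ) := fun j => (hφ j).continuousOn
  have hV := memLp_deriv_integratedSemigroup hS'
  -- Any point above `w` would do, as the kernel does not depend on it.
  have hl : w < w + 1 := lt_add_one w
  set c : ℕ → ℝ → domClosure A := fun j => orbitConvolution A T ((w + 1 : ℝ) : 𝕜) (φ j) with hc
  have hnoise : ∀ N o, ContinuousOn (finiteRankNoise η φ N o) (Icc 0 τ) := fun N o =>
    continuousOn_finsetSum _ fun j _ => (hφc j).const_smul (η j o)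
  have hX : ∀ t, (fun o => ((T t ξ + hη'.series 𝕜 (domClosure A) (fun j => c j t) o :
      domClosure A) : H)) =ᵐ[P]
      fun o => (solutionCurve hη' A T ((w + 1 : ℝ) : 𝕜) φ ξ t o : H) := fun t => by
    filter_upwards [coeFn_solutionCurve (φ := φ) (T := T) hη' ((w + 1 : ℝ) : 𝕜) ξ t] with o ho
    rw [ho]
  have hXN : ∀ N, ∀ t ∈ Icc 0 τ, ∀ o,
      ((T t ξ + orbitConvolution A T ((w + 1 : ℝ) : 𝕜) (finiteRankNoise η φ N o) t :
        domClosure A) : H) =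
      ((T t ξ + ∑ j ∈ Finset.range N, η j o • c j t : domClosure A) : H) := fun N t ht o => by
    rw [← hA.orbitConvolution_sum hV hl (Finset.range N) (fun j => η j o) hφc ht]
    rfl
  have hXN' : ∀ N, ∀ t ∈ Icc 0 τ, (fun o => ((T t ξ + orbitConvolution A T ((w + 1 : ℝ) : 𝕜)
      (finiteRankNoise η φ N o) t : domClosure A) : H)) =ᵐ[P]
      fun o => (approxCurve hη' A T ((w + 1 : ℝ) : 𝕜) φ ξ N t o : H) := fun N t ht => by
    filter_upwards [coeFn_approxCurve (φ := φ) (T := T) hη' ((w + 1 : ℝ) : 𝕜) ξ N t] with o ho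
    rw [ho, hXN N t ht]
  refine ⟨fun N t o => ((T t ξ + orbitConvolution A T ((w + 1 : ℝ) : 𝕜)
      (finiteRankNoise η φ N o) t : domClosure A) : H),
    fun t o => ((T t ξ + hη'.series 𝕜 (domClosure A) (fun j => c j t) o : domClosure A) : H),
    fun N o => ⟨hA.isIntegratedSolution hV hl hτ.le (hnoise N o) ξ, fun u hu =>
      hA.eqOn_of_isIntegratedSolution hl hu
        (hA.isIntegratedSolution hV hl hτ.le (hnoise N o) ξ)⟩,
    fun N => memMeanSquareC_of_continuousOn
      (continuousOn_approxCurve hη' hA hl hS' hφc ξ hτ.le N) (hXN' N) fun t ht => ?_,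
    memMeanSquareC_of_continuousOn (continuousOn_solutionCurve hη' hA hl hS' hφc hbφ ξ hτ.le)
      (fun t _ => hX t) fun t ht => ?_, ?_,
    fun t ht => ⟨_, isStochasticIntegral_series hη' hA hl hS' hφc hbφ ht,
      Eventually.of_forall fun o => rfl⟩,
    isIntegratedSolutionWithNoise_of_ae_eq hη' hA hl hS' hφc hbφ ξ hτ.le fun t _ => hX t,
    -- These versions are built from one representative of the series. The exceptional null sets
    -- therefore do not vary with the continuous parameter `l`, and the limit exists at every
    -- outcome.
    fun l t o => (((l : 𝕜) • resolventOnClosure A (l : 𝕜)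
      (hη'.series 𝕜 (domClosure A) (fun j => c j t) o) : domClosure A) : H),
    fun l hwl t ht => isStochasticIntegral_regularized hη' hA hl hS' hφc hbφ hwl ht,
    fun t ht => ⟨Eventually.of_forall fun o => ⟨_, (continuous_subtype_val.tendsto _).comp
      (hA.tendsto_smul_opResolventClosure (hη'.series 𝕜 (domClosure A) (fun j => c j t) o)),
        rfl⟩, ?_⟩⟩
  · simp_rw [hXN N t ht, Submodule.coe_add, Submodule.coe_sum]
    refine StronglyMeasurable.add stronglyMeasurable_const
      (Finset.stronglyMeasurable_fun_sum _ fun j _ => ?_)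
    exact (measurable_coefficient hη hη'.memLp j).stronglyMeasurable.smul_const _
  · exact stronglyMeasurable_const.add (stronglyMeasurable_series hη' hA hl hS' hφc hbφ ht)
  · rw [ENNReal.tendsto_nhds_zero]
    intro ε hε
    obtain ⟨δ, hδ, hδε⟩ := ENNReal.lt_iff_exists_real_btwn.1 hε
    have hδ' : 0 < δ := by simpa using hδε.1
    filter_upwards [eventually_norm_solutionCurve_sub_le hη' hA hl hS' hφc hbφ ξ hτ.le hδ']
      with N hN
    refine (iSup₂_le fun t ht => ?_).trans hδε.2.le
    have h1 := hN t ht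
    rw [← dist_eq_norm, dist_comm, ← ENNReal.ofReal_le_ofReal_iff hδ'.le, ← edist_dist,
      Lp.edist_def, ← eLpNorm_coe_submodule] at h1
    refine (eLpNorm_congr_ae ?_).trans_le h1
    filter_upwards [hX t, hXN' N t ht] with o h2 h3
    rw [Pi.sub_apply, h2, h3]
    rfl
  · refine (hA.tendsto_eLpNorm_regularized (hη'.series 𝕜 (domClosure A) fun j => c j t)).congr
      fun l => ?_
    rw [← eLpNorm_coe_submodule]
    refine eLpNorm_congr_ae (Eventually.of_forall fun o => ?_)
    simp only [Submodule.coe_add, Submodule.coe_sub]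
    abel
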